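/- **Notation.** All operators are linear operators on $\mathbb{C}[x]$ and products are compositions; $x$ denotes multiplication by $x$, $D=d/dx$, $h_\theta$ is the diagonal operator $x^n\mapsto h_nx^n$, and $\ell(D)$ is defined for $\ell\in\mathbb{C}[[y]]$. On $\mathbb{C}[[y]]$, $h_\theta y^n=h_ny^n$ and $L g=(g-g(0))/y$. Write $(z)_n=z(z-1)\cdots(z-n+1)$. For $f\in y+y^2\mathbb{C}[[y]]$, $C_f$ is the operator $x^n\mapsto p_n(x)$ with $e^{xy}=\sum_n p_n(x)f(y)^n/n!$. For an operator $T$ on $\mathbb{C}[x]$, $\overline{T}$ is the operator on $\mathbb{C}[[y]]$ with $T_x e^{xy}=\overline{T}_ye^{xy}$, i.e. $\overline T\ell=\sum_k\frac{y^k}{k!}\big[\ell(D)Tx^k\big]_{x=0}$. For a sequence $\ell=(\ell_n)_{n\ge0}$, $\tilde C_\ell$ is the invertible operator with $\tilde C_\ell^{-1}x\tilde C_\ell=x-\ell_\theta$, $\tilde C_\ell\cdot 1=1$. Complex powers of series with constant term $1$ are given by the binomial series. If $p_n$ is a family of monic polynomials with $\deg p_n=n$, its operator is $G:x^n\mapsto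 p_n$, and its dual raising operator is $G^{-1}xG$. **Data.** Let $\lambda,\kappa\in\mathbb{C}\setminus\{0\}$ with $\frac1\kappa-\frac1\lambda=\frac12$, let $a,h,r,\tilde r\in\mathbb{C}$, $\beta=r\kappa+(1-r)\lambda$, $\tilde\beta=\tilde r\kappa+(1-\tilde r)\lambda$, $f(y)=y/(1-\frac12\lambda ay)$ (so $f'=(1+\frac12\lambda af)^2$), and let $\omega$ be the functional inverse of $f/f'$. Put $$\eta(z)=\frac{h(1+\beta z)(1+\lambda(z+1))^2+(1-h)(1+\tilde\beta z)}{(1+\lambda z)(1+\kappa z)},\qquad \frac{\mathcal H_{z+n}}{\mathcal H_z}=\prod_{k=0}^{n-1}\eta(z+k),\quad \mathcal H_0=1,$$ $$\tilde C_2(c)=\tilde C_{\ell^{(c)}},\qquad \ell^{(c)}_n=\frac{2ah\lambda^2}{\kappa}(1+n+c)(1+\beta(n+c)).$$ For $\rho\in\mathbb{C}$ let $$A^{J}_\rho(z)=\rho a+(1-\rho)\frac a2\Big(\frac{2+\lambda z}{1+\kappa z}+\frac{\lambda z}{1+\kappa(z-1)}\Big),\quad S^{J}_\rho(z)=\frac{\lambda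 a^2}{4}(2+\lambda z)\Big(\frac{\rho}{1+\lambda(z+1)}+\frac{1-\rho}{1+\kappa z}\Big),$$ and $A(z)=h(1+\lambda z)^2A^J_r(z)+(1-h)A^J_{\tilde r}(z)$, $S(z)=h(1+\lambda z)^2S^J_r(z)+(1-h)S^J_{\tilde r}(z)$, $B(z)=S(z-1)\eta(z-1)$. Call $c\in\mathbb{C}$ *regular* if for all integers $n\ge0$ one has $1+\lambda(c+n)\ne0$, $1+\kappa(c+n)\ne0$, $\eta(c+n)\neq0$, $c+n+1\ne0$, and moreover, if $c\neq0$, $1+\lambda(c-1)\ne0$ and $1+\kappa(c-1)\neq0$. (For $c=0$, the term $\lambda z/(1+\kappa(z-1))$ at $z=0$ is read as $0$, and $(c+n-1)_n\mathcal H_{c+n-1}/\mathcal H_{c-1}$ is read as $0$ for $n\ge1$.) **Claim.** 1. (Wilson family.) If $0$ is regular, then $G_{\mathcal W}=\tilde C_2(0)\,\mathcal H_\theta^{-1}C_{f/f'}^{-1}f'(D)^{-1/\lambda}C_f\,\mathcal H_\theta$ is the operator of a family of monic polynomials, with dual raising operator $x+A(\theta)+D\,B(\theta)$. 2. (Associated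 family.) For every regular $c$ there is exactly one family of monic polynomials with the associated dual raising operator $$U_{\mathcal W^*}(c)=x+A(\theta+c)+\frac{(1+c+\theta)\,B(\theta+c+1)}{1+\theta}D,$$ and its operator is $$G_{\mathcal W}(c)=\theta!\,s(c,D)\,\theta!^{-1}\,\tilde C_2(c)\,\frac{\theta!}{(c+\theta)_\theta}\,\frac{\mathcal H_c}{\mathcal H_{\theta+c}}\,C_{f/f'}^{-1}f'(D)^{-c-1/\lambda}C_f\,\frac{\mathcal H_{\theta+c}}{\mathcal H_c}\,\frac{(c+\theta)_\theta}{\theta!},$$ where $$s(c,y)=1+y\,\theta!\,\overline{\tilde C_2(c)^{-1}}\,\theta!^{-1}\,L\,(c+\theta-1)_\theta\,\frac{\mathcal H_{\theta+c-1}}{\mathcal H_{c-1}}\cdot f'(\omega(y))^{c-1+1/\lambda}.$$ 3. For every sequence $\ell$, the operator $\tilde C_\ell$ exists, is unique, and $\tilde C_\ell\cdot x^n=\prod_{k=0}^{n-1}(x+\ell_k)$. 4. (Factorization behind hypergeometricity.) For every sequence $\ell$ and every $n\ge0$, $$\theta!\,\overline{\tilde C_\ell^{-1}}\,\theta!^{-1}\cdot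 y^n=\frac{y^n}{\prod_{k=0}^{n}(1+y\ell_k)}.$$ -/

import Mathlib

open Polynomial PowerSeries

namespace WilsonAssoc

/-! ### Formal power series -/

/-- The functional inverse of a series `f` with `f(0) = 0` and `f'(0)` invertible. -/
noncomputable def compInv (f : ℂ⟦X⟧) : ℂ⟦X⟧ :=
  open Classical in
  if h : IsUnit (PowerSeries.coeff 1 f) then f.substInvOfIsUnit h else 0

theorem subst_compInv (f : ℂ⟦X⟧) (h0 : PowerSeries.constantCoeff f = 0)
    (h1 : PowerSeries.coeff 1 f ≠ 0) : f.subst (compInv f) = PowerSeries.X := by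
  have h : IsUnit (PowerSeries.coeff 1 f) := isUnit_iff_ne_zero.mpr h1
  rw [compInv, dif_pos h]
  exact PowerSeries.subst_substInvOfIsUnit_right f h0 h

theorem compInv_subst (f : ℂ⟦X⟧) (h0 : PowerSeries.constantCoeff f = 0)
    (h1 : PowerSeries.coeff 1 f ≠ 0) : (compInv f).subst f = PowerSeries.X := by
  have h : IsUnit (PowerSeries.coeff 1 f) := isUnit_iff_ne_zero.mpr h1
  rw [compInv, dif_pos h]
  exact PowerSeries.subst_substInvOfIsUnit_left f h0 h

/-- The complex power `g ^ s = ∑ binom(s, n) (g - 1) ^ n` of a series `g` with `g(0) = 1`. -/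
noncomputable def cpow (g : ℂ⟦X⟧) (s : ℂ) : ℂ⟦X⟧ :=
  (PowerSeries.binomialSeries ℂ s).subst (g - 1)

/-- The transform `f / f'`, for `f'(0)` nonzero. -/
noncomputable def frakT (f : ℂ⟦X⟧) : ℂ⟦X⟧ :=
  f * (PowerSeries.derivative ℂ f)⁻¹

/-- The diagonal operator `h_θ` on series, `y ^ n ↦ h_n y ^ n`. -/
noncomputable def sdiag (h : ℕ → ℂ) (g : ℂ⟦X⟧) : ℂ⟦X⟧ :=
  PowerSeries.mk fun n => h n * PowerSeries.coeff n g

/-- The `0`-derivative on series, `g ↦ (g - g(0)) / y`. -/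
noncomputable def zeroDeriv (g : ℂ⟦X⟧) : ℂ⟦X⟧ :=
  PowerSeries.mk fun n => PowerSeries.coeff (n + 1) g

/-! ### Operators on polynomials -/

/-- Linear operators on `ℂ[x]`; multiplication is composition. -/
abbrev Op : Type := Module.End ℂ ℂ[X]

/-- The operator with `x ^ n ↦ v n`. -/
noncomputable def ofMonomials (v : ℕ → ℂ[X]) : Op :=
  (Polynomial.basisMonomials ℂ).constr ℂ v

theorem ofMonomials_X_pow (v : ℕ → ℂ[X]) (n : ℕ) :
    ofMonomials v (Polynomial.X ^ n) = v n := by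
  have h := (Polynomial.basisMonomials ℂ).constr_basis ℂ v n
  rw [Polynomial.X_pow_eq_monomial, ← h]
  simp [ofMonomials]

/-- The operator of multiplication by `x`. -/
noncomputable def mulX : Op := LinearMap.mulLeft ℂ (Polynomial.X : ℂ[X])

/-- The operator `D = d/dx`. -/
noncomputable def opD : Op := Polynomial.derivative

/-- The diagonal operator `h_θ`, `x ^ n ↦ h_n x ^ n`. -/
noncomputable def diag (h : ℕ → ℂ) : Op :=
  ofMonomials fun n => Polynomial.C (h n) * Polynomial.X ^ n

/-- The operator `ℓ(D)`. On `x ^ n` only the terms `D ^ k` with `k ≤ n` contribute. -/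
noncomputable def serD (l : ℂ⟦X⟧) : Op :=
  ofMonomials fun n => ∑ k ∈ Finset.range (n + 1),
    PowerSeries.coeff k l • (opD ^ k) ((Polynomial.X : ℂ[X]) ^ n)

/-- The umbral operator `C_f`, `x ^ n ↦ p_n(x)`, where `p_n` is the family of binomial type with
`e ^ (x y) = ∑ p_n(x) f(y) ^ n / n!`, that is, `p_n(x) = n! [y ^ n] e ^ (x φ(y))` with `φ` the
functional inverse of `f`. -/
noncomputable def umbral (f : ℂ⟦X⟧) : Op :=
  ofMonomials fun n => ∑ k ∈ Finset.range (n + 1),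
    Polynomial.C (((n.factorial : ℂ) / (k.factorial : ℂ)) * PowerSeries.coeff n (compInv f ^ k)) *
      Polynomial.X ^ k

/-- The operator on series determined by `T_x e ^ (x y) = (bar T)_y e ^ (x y)`:
`(bar T) l = ∑ y ^ k / k! [l(D) T x ^ k] at x = 0`. -/
noncomputable def bar (T : Op) (l : ℂ⟦X⟧) : ℂ⟦X⟧ :=
  PowerSeries.mk fun k =>
    (1 / (k.factorial : ℂ)) * Polynomial.eval 0 (serD l (T ((Polynomial.X : ℂ[X]) ^ k)))

/-- The operator `x ^ n ↦ ∏_{k < n} (x + ℓ_k)`. -/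
noncomputable def tildeC (l : ℕ → ℂ) : Op :=
  ofMonomials fun n => ∏ k ∈ Finset.range n, (Polynomial.X + Polynomial.C (l k))

/-- `G` is the (invertible) operator `x ^ n ↦ p_n(x)` of a family of monic polynomials, and its
dual raising operator `G⁻¹ x G` is `U`. -/
def IsFamilyOperator (G U : Op) : Prop :=
  (∀ n : ℕ, (G (Polynomial.X ^ n)).Monic ∧ (G (Polynomial.X ^ n)).natDegree = n) ∧
    IsUnit G ∧ Ring.inverse G * mulX * G = U

/-- The dual raising operator `x + A_θ + D B_θ`. -/
noncomputable def dualRaising (A B : ℂ → ℂ) : Op :=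
  mulX + diag (fun n => A n) + opD * diag (fun n => B n)

/-- The dual raising operator `x + A_{θ+c} + (1+c+θ) B_{θ+c+1} / (1+θ) D` of the associated
family. -/
noncomputable def assocDualRaising (A B : ℂ → ℂ) (c : ℂ) : Op :=
  mulX + diag (fun n => A (n + c)) +
    diag (fun n => (1 + c + n) * B (n + c + 1) / (1 + n)) * opD

/-- The falling factorial `(z)_n = z (z - 1) ... (z - n + 1)`. -/
noncomputable def falling (z : ℂ) (n : ℕ) : ℂ := (descPochhammer ℂ n).eval z

/-! ### The Wilson family and its associated families -/

/-- The parameters of the Wilson family; `r2` is the second (tilde) mixing parameter. -/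
structure Params where
  lam : ℂ
  kap : ℂ
  a : ℂ
  h : ℂ
  r : ℂ
  r2 : ℂ

namespace Params

/-- `β = r κ + (1 - r) λ`. -/
noncomputable def beta (P : Params) : ℂ := P.r * P.kap + (1 - P.r) * P.lam

/-- The second parameter, `r2 κ + (1 - r2) λ`. -/
noncomputable def beta2 (P : Params) : ℂ := P.r2 * P.kap + (1 - P.r2) * P.lam

/-- The series `f(y) = y / (1 - λ a y / 2)`, the solution of `f' = (1 + λ a f / 2) ^ 2`,
`f(0) = 0`. -/
noncomputable def f (P : Params) : ℂ⟦X⟧ :=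
  PowerSeries.X * (1 - PowerSeries.C (P.lam * P.a / 2) * PowerSeries.X)⁻¹

/-- The derivative `f'`. -/
noncomputable def df (P : Params) : ℂ⟦X⟧ := PowerSeries.derivative ℂ P.f

/-- The series `ω`, the functional inverse of `f / f'`. -/
noncomputable def omega (P : Params) : ℂ⟦X⟧ := compInv (frakT P.f)

/-- The ratio `𝓗_{z+1} / 𝓗_z`. -/
noncomputable def ratio (P : Params) (z : ℂ) : ℂ :=
  (P.h * (1 + P.beta * z) * (1 + P.lam * (z + 1)) ^ 2 + (1 - P.h) * (1 + P.beta2 * z)) /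
    ((1 + P.lam * z) * (1 + P.kap * z))

/-- The quotient `𝓗_{z+n} / 𝓗_z`. -/
noncomputable def calH (P : Params) (z : ℂ) (n : ℕ) : ℂ := ∏ k ∈ Finset.range n, P.ratio (z + k)

/-- The diagonal coefficient of the Jacobi operator with mixing parameter `r`, after conjugation
by its diagonal operator. -/
noncomputable def jacobiDiag (P : Params) (r z : ℂ) : ℂ :=
  r * P.a + (1 - r) *
    (1 / 2 * P.a * ((2 + P.lam * z) / (1 + P.kap * z)) +
      1 / 2 * P.a * (P.lam * z / (1 + P.kap * (z - 1))))

/-- The coefficient of `D` in the Jacobi operator with mixing parameter `r`, after conjugation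
by its diagonal operator. -/
noncomputable def jacobiLow (P : Params) (r z : ℂ) : ℂ :=
  r * (1 / 4 * P.lam * P.a ^ 2 * ((2 + P.lam * z) / (1 + P.lam * (z + 1)))) +
    (1 - r) * (1 / 4 * P.lam * P.a ^ 2 * ((2 + P.lam * z) / (1 + P.kap * z)))

/-- The Wilson recurrence coefficient `A_z`: the affine combination, with weight `h`, of the Jacobi
coefficient multiplied by `(1 + λ z) ^ 2` and of the second Jacobi coefficient. -/
noncomputable def wilsonA (P : Params) (z : ℂ) : ℂ :=
  P.h * (1 + P.lam * z) ^ 2 * P.jacobiDiag P.r z + (1 - P.h) * P.jacobiDiag P.r2 z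

/-- The same affine combination for the coefficient of `D`. -/
noncomputable def wilsonLow (P : Params) (z : ℂ) : ℂ :=
  P.h * (1 + P.lam * z) ^ 2 * P.jacobiLow P.r z + (1 - P.h) * P.jacobiLow P.r2 z

/-- The Wilson recurrence coefficient `B_z`, so that `D B_θ = B_{θ+1} D` with
`B_{z+1} = wilsonLow z * 𝓗_{z+1} / 𝓗_z`. -/
noncomputable def wilsonB (P : Params) (z : ℂ) : ℂ := P.wilsonLow (z - 1) * P.ratio (z - 1)

/-- The sequence `ℓ_n = 2 a h λ² κ⁻¹ (1 + (n + c)) (1 + β (n + c))`. -/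
noncomputable def ell (P : Params) (c : ℂ) (n : ℕ) : ℂ :=
  2 * P.a * P.h * P.lam ^ 2 * P.kap⁻¹ * (1 + (n + c)) * (1 + P.beta * (n + c))

/-- The operator with `C⁻¹ x C = x - ℓ_θ`, `C 1 = 1` for the above `ℓ`. -/
noncomputable def C2 (P : Params) (c : ℂ) : Op := tildeC (P.ell c)

/-- The operator of the Wilson family,
`C₂ 𝓗_θ⁻¹ C_{f/f'}⁻¹ f'(D) ^ (-1/λ) C_f 𝓗_θ`. -/
noncomputable def wilsonG (P : Params) : Op :=
  P.C2 0 * diag (fun n => (P.calH 0 n)⁻¹) * Ring.inverse (umbral (frakT P.f)) *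
    serD (cpow P.df (-1 / P.lam)) * umbral P.f * diag (fun n => P.calH 0 n)

/-- The series
`s(c, y) = 1 + y θ! bar(C₂(c)⁻¹) θ!⁻¹ L (c+θ-1)_θ 𝓗_{c-1}⁻¹ 𝓗_{θ+c-1} f'(ω(y)) ^ (c-1+1/λ)`. -/
noncomputable def s (P : Params) (c : ℂ) : ℂ⟦X⟧ :=
  1 + PowerSeries.X *
    sdiag (fun n => (n.factorial : ℂ))
      (bar (Ring.inverse (P.C2 c))
        (sdiag (fun n => (n.factorial : ℂ)⁻¹)
          (zeroDeriv
            (sdiag (fun n => falling (c + n - 1) n * P.calH (c - 1) n)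
              (cpow (P.df.subst P.omega) (c - 1 + 1 / P.lam))))))

/-- The explicit operator `G_W(c)`. -/
noncomputable def assocG (P : Params) (c : ℂ) : Op :=
  diag (fun n => (n.factorial : ℂ)) * serD (P.s c) * diag (fun n => (n.factorial : ℂ)⁻¹) *
    P.C2 c *
    diag (fun n => (n.factorial : ℂ) / falling (c + n) n) *
    diag (fun n => (P.calH c n)⁻¹) *
    Ring.inverse (umbral (frakT P.f)) * serD (cpow P.df (-c - 1 / P.lam)) * umbral P.f *
    diag (fun n => P.calH c n) *
    diag (fun n => falling (c + n) n / (n.factorial : ℂ))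

/-- The expressions in the recurrence and in `G_W(c)` have no poles, and the diagonal operators
`𝓗_{θ+c} / 𝓗_c` and `(c+θ)_θ` are invertible. For `c = 0` the terms involving the index `c - 1`
come with the factor `c`, so that nothing has to be required there. -/
def Regular (P : Params) (c : ℂ) : Prop :=
  (∀ n : ℕ, 1 + P.lam * (c + n) ≠ 0 ∧ 1 + P.kap * (c + n) ≠ 0 ∧ P.ratio (c + n) ≠ 0 ∧
    c + n + 1 ≠ 0) ∧
  (c ≠ 0 → 1 + P.lam * (c - 1) ≠ 0 ∧ 1 + P.kap * (c - 1) ≠ 0)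

theorem df_eq (P : Params) :
    PowerSeries.derivative ℂ P.f = (1 + PowerSeries.C (P.lam * P.a / 2) * P.f) ^ 2 := by
  set b : ℂ⟦X⟧ := PowerSeries.C (P.lam * P.a / 2) with hb
  have hc : PowerSeries.constantCoeff (1 - b * PowerSeries.X) ≠ 0 := by simp
  have h1 : (1 - b * PowerSeries.X) * (1 - b * PowerSeries.X)⁻¹ = 1 :=
    PowerSeries.mul_inv_cancel _ hc
  have hf : P.f * (1 - b * PowerSeries.X) = PowerSeries.X := by
    calc P.f * (1 - b * PowerSeries.X)
        = PowerSeries.X * ((1 - b * PowerSeries.X) * (1 - b * PowerSeries.X)⁻¹) := by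
          rw [Params.f]; ring
      _ = PowerSeries.X := by rw [h1, mul_one]
  have hd := congrArg (PowerSeries.derivative ℂ) hf
  have hdb : PowerSeries.derivative ℂ b = 0 := by rw [hb]; exact PowerSeries.derivative_C
  simp only [Derivation.leibniz, map_sub, smul_eq_mul, hdb, PowerSeries.derivative_X,
    Derivation.map_one_eq_zero] at hd
  linear_combination (1 + b * P.f) * hd - b * PowerSeries.derivative ℂ P.f * hf

end Params

/-- The defining generating function `e ^ (x y) = ∑ p_n(x) f(y) ^ n / n!` of `C_f`, in the
coefficient of `x ^ k y ^ N`. -/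
theorem umbral_genFun (f : ℂ⟦X⟧) (h0 : PowerSeries.constantCoeff f = 0)
    (h1 : PowerSeries.coeff 1 f = 1) (k N : ℕ) :
    ∑ n ∈ Finset.range (N + 1), (umbral f (Polynomial.X ^ n)).coeff k *
        PowerSeries.coeff N (f ^ n) / (n.factorial : ℂ) =
      if k = N then 1 / (N.factorial : ℂ) else 0 := by
  have h1' : PowerSeries.coeff 1 f ≠ 0 := by rw [h1]; exact one_ne_zero
  have hs : PowerSeries.HasSubst f := PowerSeries.HasSubst.of_constantCoeff_zero' h0
  have hphi : PowerSeries.constantCoeff (compInv f) = 0 := by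
    have h : IsUnit (PowerSeries.coeff 1 f) := isUnit_iff_ne_zero.mpr h1'
    rw [compInv, dif_pos h]
    exact PowerSeries.constantCoeff_substInvOfIsUnit f h
  have hz : ∀ (g : ℂ⟦X⟧), PowerSeries.constantCoeff g = 0 → ∀ m j : ℕ, m < j →
      PowerSeries.coeff m (g ^ j) = 0 := by
    intro g hg m j hmj
    exact (PowerSeries.X_pow_dvd_iff.mp (pow_dvd_pow_of_dvd (PowerSeries.X_dvd_iff.mpr hg) j)) m hmj
  have hu : ∀ n : ℕ, (umbral f (Polynomial.X ^ n)).coeff k =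
      ((n.factorial : ℂ) / (k.factorial : ℂ)) * PowerSeries.coeff n (compInv f ^ k) := by
    intro n
    rw [umbral, ofMonomials_X_pow, Polynomial.finsetSum_coeff]
    simp only [Polynomial.coeff_C_mul, Polynomial.coeff_X_pow, mul_ite, mul_one, mul_zero]
    rw [Finset.sum_ite_eq]
    split_ifs with hk
    · rfl
    · rw [hz _ hphi n k (by simpa [Nat.lt_succ_iff] using hk), mul_zero]
  have key : PowerSeries.coeff N ((compInv f ^ k).subst f) =
      ∑ n ∈ Finset.range (N + 1),
        PowerSeries.coeff n (compInv f ^ k) * PowerSeries.coeff N (f ^ n) := by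
    rw [PowerSeries.coeff_subst' hs]
    apply finsum_eq_sum_of_support_subset
    intro n hn
    simp only [Finset.coe_range, Set.mem_Iio]
    by_contra hlt
    exact hn (by simp only [smul_eq_mul]; rw [hz f h0 N n (by omega), mul_zero])
  rw [PowerSeries.subst_pow hs, compInv_subst f h0 h1', PowerSeries.coeff_X_pow] at key
  calc _ = (1 / (k.factorial : ℂ)) * ∑ n ∈ Finset.range (N + 1),
        PowerSeries.coeff n (compInv f ^ k) * PowerSeries.coeff N (f ^ n) := by
        rw [Finset.mul_sum]
        refine Finset.sum_congr rfl fun n _ => ?_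
        rw [hu]
        have : (n.factorial : ℂ) ≠ 0 := Nat.cast_ne_zero.mpr n.factorial_ne_zero
        field_simp
    _ = _ := by
        rw [← key]
        by_cases h : k = N
        · subst h; simp
        · rw [if_neg h, if_neg (fun e => h e.symm), mul_zero]

end WilsonAssoc

open WilsonAssoc

namespace WilsonAssoc

/-! ### Operators and their transposes -/

/-! For a tridiagonal `U` with leading term `x`, a family with dual raising operator `U` is the same
as an operator `G` with `G 1 = 1` and `x G = G U` (`isFamilyOperator_iff`): this equation is a
recurrence for `G x^n`, which forces monicity and uniqueness. It therefore suffices to check `x G =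
G U` for the explicit operator.

Write `G_W(c) = S C V` with `S = θ! s(c,D) θ!⁻¹`, `C = C2 c` and `V = conjCore c`. Transposition
through `e^(xy)` makes the entries of `V` explicit. With `b = λa/2`, the inverse `φ = y/(1+by)` of
`f` turns `f'` into `(1+by)^2`, so the transpose of `C_{f/f'}⁻¹ f'(D)^t C_f` is `l ↦ (1+by)^(2t)
l(y(1+by)^(-2))` (`bar_core`), and the entries of `V` are binomial coefficients times quotients of
weights. Compared entry by entry, `(x - ℓ_θ) V = V U` is a rational identity (`wilson_recurrence`).
It fails only in row 0, because `x V` has no contribution from a row `-1`; the missing term is a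
functional with values in the constants, `defect` (`sub_mul_conjCore`).

The operator `C` turns `x - ℓ_θ` into `x`. The operator `S` commutes with `x` up to another
functional into the constants, whose values are the coefficients of `s` (`mulX_mul_conj_serD`). The
series `s` is the one for which this functional, pulled back along `C V`, equals the defect
(`correction_apply`), so the two errors cancel in `mulX_mul_assocG`. At `c = 0` the defect vanishes
and `s = 1`, which gives the Wilson family.

The factorization in the last claim is a first-order recursion for the generating functions of the
rows of `tildeC l` inverse. -/

theorem op_ext {M : Type*} [AddCommMonoid M] [Module ℂ M] {S T : ℂ[X] →ₗ[ℂ] M}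
    (h : ∀ n : ℕ, S ((Polynomial.X : ℂ[X]) ^ n) = T (Polynomial.X ^ n)) : S = T := by
  refine (Polynomial.basisMonomials ℂ).ext fun n => ?_
  simpa [Polynomial.X_pow_eq_monomial] using h n

theorem factorial_cast_ne_zero (n : ℕ) : (n.factorial : ℂ) ≠ 0 :=
  Nat.cast_ne_zero.mpr n.factorial_ne_zero

theorem mulX_apply (p : ℂ[X]) : mulX p = Polynomial.X * p := rfl

theorem diag_X_pow (h : ℕ → ℂ) (n : ℕ) :
    diag h (Polynomial.X ^ n) = h n • (Polynomial.X : ℂ[X]) ^ n := by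
  rw [diag, ofMonomials_X_pow, Polynomial.smul_eq_C_mul]

theorem diag_mul_diag (g h : ℕ → ℂ) : diag g * diag h = diag fun n => g n * h n := by
  refine op_ext fun n => ?_
  rw [Module.End.mul_apply, diag_X_pow, map_smul, diag_X_pow, diag_X_pow, smul_smul, mul_comm]

theorem coeff_diag (h : ℕ → ℂ) (p : ℂ[X]) (n : ℕ) : (diag h p).coeff n = h n * p.coeff n := by
  have : (Polynomial.lcoeff ℂ n) ∘ₗ diag h = h n • Polynomial.lcoeff ℂ n := by
    refine op_ext fun m => ?_
    simp only [LinearMap.comp_apply, diag_X_pow, LinearMap.smul_apply, Polynomial.lcoeff_apply,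
      Polynomial.coeff_smul, Polynomial.coeff_X_pow, smul_eq_mul]
    split_ifs with e
    · rw [e]
    · simp
  exact LinearMap.congr_fun this p

theorem opD_pow_X_pow (k n : ℕ) : (opD ^ k) ((Polynomial.X : ℂ[X]) ^ n) =
    (n.descFactorial k : ℂ) • (Polynomial.X : ℂ[X]) ^ (n - k) := by
  rw [Module.End.pow_apply]
  have := Polynomial.iterate_derivative_X_pow_eq_smul (R := ℂ) n k
  rw [opD, this, Nat.cast_smul_eq_nsmul]

theorem serD_X_pow (l : ℂ⟦X⟧) (n : ℕ) : serD l (Polynomial.X ^ n) =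
    ∑ k ∈ Finset.range (n + 1),
      (PowerSeries.coeff k l * n.descFactorial k) • (Polynomial.X : ℂ[X]) ^ (n - k) := by
  rw [serD, ofMonomials_X_pow]
  refine Finset.sum_congr rfl fun k _ => ?_
  rw [opD_pow_X_pow, smul_smul]

/-- The pairing `(l, p) ↦ [l(D) p] at x = 0` of series with polynomials. -/
noncomputable def pairing (l : ℂ⟦X⟧) : ℂ[X] →ₗ[ℂ] ℂ :=
  (Polynomial.basisMonomials ℂ).constr ℂ fun n => (n.factorial : ℂ) * PowerSeries.coeff n l

theorem pairing_X_pow (l : ℂ⟦X⟧) (n : ℕ) :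
    pairing l (Polynomial.X ^ n) = (n.factorial : ℂ) * PowerSeries.coeff n l := by
  have h := (Polynomial.basisMonomials ℂ).constr_basis ℂ
    (fun n => (n.factorial : ℂ) * PowerSeries.coeff n l) n
  rw [Polynomial.X_pow_eq_monomial, ← h]
  simp [pairing]

theorem eval_serD (l : ℂ⟦X⟧) (p : ℂ[X]) : Polynomial.eval 0 (serD l p) = pairing l p := by
  have : (Polynomial.leval (0 : ℂ)) ∘ₗ serD l = pairing l := by
    refine op_ext fun n => ?_
    rw [LinearMap.comp_apply, Polynomial.leval_apply, serD_X_pow, Polynomial.eval_finsetSum,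
      pairing_X_pow, Finset.sum_range_succ, Finset.sum_eq_zero]
    · simp [Nat.descFactorial_self, mul_comm]
    · intro k hk
      have : n - k ≠ 0 := by have := Finset.mem_range.mp hk; omega
      simp [this]
  exact LinearMap.congr_fun this p

theorem coeff_bar (T : Op) (l : ℂ⟦X⟧) (k : ℕ) : PowerSeries.coeff k (bar T l) =
    (k.factorial : ℂ)⁻¹ * pairing l (T (Polynomial.X ^ k)) := by
  rw [bar, PowerSeries.coeff_mk, eval_serD, one_div]

/-- `bar T` is the adjoint of `T` for the pairing; hence `bar` reverses products, and functionals
can be moved through operators. -/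
theorem pairing_bar (T : Op) (l : ℂ⟦X⟧) (p : ℂ[X]) :
    pairing (bar T l) p = pairing l (T p) := by
  have : pairing (bar T l) = pairing l ∘ₗ T := by
    refine op_ext fun n => ?_
    rw [pairing_X_pow, coeff_bar, LinearMap.comp_apply,
      mul_inv_cancel_left₀ (factorial_cast_ne_zero n)]
  exact LinearMap.congr_fun this p

theorem bar_mul (S T : Op) (l : ℂ⟦X⟧) : bar (S * T) l = bar T (bar S l) := by
  ext k
  rw [coeff_bar, coeff_bar, pairing_bar, Module.End.mul_apply]

theorem pairing_series_X_pow (n : ℕ) (p : ℂ[X]) :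
    pairing (PowerSeries.X ^ n) p = (n.factorial : ℂ) * p.coeff n := by
  have : pairing (PowerSeries.X ^ n) = (n.factorial : ℂ) • Polynomial.lcoeff ℂ n := by
    refine op_ext fun m => ?_
    rw [pairing_X_pow, PowerSeries.coeff_X_pow, LinearMap.smul_apply, Polynomial.lcoeff_apply,
      Polynomial.coeff_X_pow, smul_eq_mul]
    by_cases h : m = n
    · simp [h]
    · simp [h, Ne.symm h]
  exact LinearMap.congr_fun this p

theorem coeff_apply_X_pow (T : Op) (m n : ℕ) : (T (Polynomial.X ^ m)).coeff n =
    (m.factorial : ℂ) / n.factorial * PowerSeries.coeff m (bar T (PowerSeries.X ^ n)) := by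
  have hm := factorial_cast_ne_zero m
  have hn := factorial_cast_ne_zero n
  rw [coeff_bar, pairing_series_X_pow]
  field_simp

/-- Pairing with `y^n` reads off the `n`-th coefficient, so the transpose contains the whole matrix
of the operator. -/
theorem bar_injective {S T : Op} (h : ∀ l, bar S l = bar T l) : S = T := by
  refine op_ext fun m => ?_
  ext n
  rw [coeff_apply_X_pow, coeff_apply_X_pow, h]

theorem bar_diag (h : ℕ → ℂ) (l : ℂ⟦X⟧) : bar (diag h) l = sdiag h l := by
  ext k
  have := factorial_cast_ne_zero k
  rw [coeff_bar, diag_X_pow, map_smul, pairing_X_pow, sdiag, PowerSeries.coeff_mk, smul_eq_mul]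
  field_simp

theorem bar_serD (g l : ℂ⟦X⟧) : bar (serD g) l = g * l := by
  ext k
  rw [coeff_bar, serD_X_pow, map_sum, PowerSeries.coeff_mul,
    Finset.Nat.sum_antidiagonal_eq_sum_range_succ
      (fun i j => PowerSeries.coeff i g * PowerSeries.coeff j l), Finset.mul_sum]
  refine Finset.sum_congr rfl fun j hj => ?_
  have hjk : j ≤ k := Nat.lt_succ_iff.mp (Finset.mem_range.mp hj)
  have hk := factorial_cast_ne_zero k
  have hd : ((k - j).factorial : ℂ) * k.descFactorial j = k.factorial := by
    exact_mod_cast Nat.factorial_mul_descFactorial hjk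
  rw [map_smul, pairing_X_pow, smul_eq_mul, ← hd]
  rw [← hd] at hk
  have h1 := left_ne_zero_of_mul hk
  have h2 := right_ne_zero_of_mul hk
  field_simp

/-- The operator whose transpose is the substitution of `φ`. -/
noncomputable def substOp (φ : ℂ⟦X⟧) : Op :=
  ofMonomials fun n => ∑ k ∈ Finset.range (n + 1),
    Polynomial.C (((n.factorial : ℂ) / (k.factorial : ℂ)) * PowerSeries.coeff n (φ ^ k)) *
      Polynomial.X ^ k

theorem coeff_pow_eq_zero_of_lt {g : ℂ⟦X⟧} (hg : PowerSeries.constantCoeff g = 0) {m j : ℕ}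
    (hmj : m < j) : PowerSeries.coeff m (g ^ j) = 0 :=
  (PowerSeries.X_pow_dvd_iff.mp (pow_dvd_pow_of_dvd (PowerSeries.X_dvd_iff.mpr hg) j)) m hmj

theorem coeff_subst_eq_sum_range {φ : ℂ⟦X⟧} (hφ : PowerSeries.constantCoeff φ = 0) (l : ℂ⟦X⟧)
    (k : ℕ) : PowerSeries.coeff k (l.subst φ) =
      ∑ j ∈ Finset.range (k + 1), PowerSeries.coeff j l * PowerSeries.coeff k (φ ^ j) := by
  rw [PowerSeries.coeff_subst' (PowerSeries.HasSubst.of_constantCoeff_zero' hφ)]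
  apply finsum_eq_sum_of_support_subset
  intro n hn
  simp only [Finset.coe_range, Set.mem_Iio]
  by_contra hlt
  exact hn (by simp only [smul_eq_mul]; rw [coeff_pow_eq_zero_of_lt hφ (by omega), mul_zero])

theorem bar_substOp {φ : ℂ⟦X⟧} (hφ : PowerSeries.constantCoeff φ = 0) (l : ℂ⟦X⟧) :
    bar (substOp φ) l = l.subst φ := by
  ext k
  rw [coeff_bar, substOp, ofMonomials_X_pow, map_sum, coeff_subst_eq_sum_range hφ, Finset.mul_sum]
  refine Finset.sum_congr rfl fun j _ => ?_
  have hk := factorial_cast_ne_zero k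
  have hj := factorial_cast_ne_zero j
  rw [← Polynomial.smul_eq_C_mul, map_smul, pairing_X_pow, smul_eq_mul]
  field_simp

theorem constantCoeff_compInv (f : ℂ⟦X⟧) : PowerSeries.constantCoeff (compInv f) = 0 := by
  rw [compInv]
  split_ifs with h
  · exact PowerSeries.constantCoeff_substInvOfIsUnit f h
  · simp

theorem substOp_mul {φ ψ : ℂ⟦X⟧} (hφ : PowerSeries.constantCoeff φ = 0)
    (hψ : PowerSeries.constantCoeff ψ = 0) (h : φ.subst ψ = PowerSeries.X) :
    substOp φ * substOp ψ = 1 := by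
  have sφ := PowerSeries.HasSubst.of_constantCoeff_zero' hφ
  have sψ := PowerSeries.HasSubst.of_constantCoeff_zero' hψ
  refine bar_injective fun l => ?_
  rw [bar_mul, bar_substOp hφ, bar_substOp hψ, PowerSeries.subst_comp_subst_apply sφ sψ, h,
    PowerSeries.X_subst]
  ext k
  have hk := factorial_cast_ne_zero k
  rw [coeff_bar, Module.End.one_apply, pairing_X_pow, inv_mul_cancel_left₀ hk]

/-- By definition `umbral g` is `substOp (compInv g)`, so its inverse is substitution of `g` itself,
with no functional inverse left. -/
theorem inverse_umbral (g : ℂ⟦X⟧) (h0 : PowerSeries.constantCoeff g = 0)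
    (h1 : PowerSeries.coeff 1 g ≠ 0) : Ring.inverse (umbral g) = substOp g := by
  have hi := constantCoeff_compInv g
  exact Ring.inverse_unit ⟨umbral g, substOp g,
    substOp_mul hi h0 (compInv_subst g h0 h1), substOp_mul h0 hi (subst_compInv g h0 h1)⟩

/-! ### Operators with a given dual raising operator -/

/-- One monic polynomial in each degree gives a basis, and `G` carries the monomial basis to it. -/
theorem isUnit_of_natDegree {G : Op}
    (h : ∀ n : ℕ, (G (Polynomial.X ^ n)).Monic ∧ (G (Polynomial.X ^ n)).natDegree = n) :
    IsUnit G := by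
  let S : Polynomial.Sequence ℂ :=
    { elems' := fun n => G (Polynomial.X ^ n)
      degree_eq' := fun n => by
        rw [Polynomial.degree_eq_natDegree (h n).1.ne_zero, (h n).2] }
  have hS : ∀ i, IsUnit (S i).leadingCoeff := fun i => by
    rw [show (S i).leadingCoeff = 1 from (h i).1]
    exact isUnit_one
  let e : ℂ[X] ≃ₗ[ℂ] ℂ[X] := (Polynomial.basisMonomials ℂ).equiv (S.basis hS) (Equiv.refl ℕ)
  have he : (e : Op) = G := by
    refine op_ext fun n => ?_
    have h1 : e (Polynomial.basisMonomials ℂ n) = S.basis hS n := by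
      rw [Module.Basis.equiv_apply]
      rfl
    rw [Polynomial.Sequence.basis_eq_self] at h1
    rw [Polynomial.X_pow_eq_monomial]
    simp only [Polynomial.coe_basisMonomials] at h1
    rw [LinearEquiv.coe_coe, h1, ← Polynomial.X_pow_eq_monomial]
  rw [← he, Module.End.isUnit_iff]
  exact e.bijective

theorem apply_X_pow_succ {G U : Op} {α γ : ℕ → ℂ}
    (hU : ∀ m : ℕ, U (Polynomial.X ^ m) =
      Polynomial.X ^ (m + 1) + α m • Polynomial.X ^ m + γ m • Polynomial.X ^ (m - 1))
    (h : mulX * G = G * U) (m : ℕ) : G (Polynomial.X ^ (m + 1)) =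
      Polynomial.X * G (Polynomial.X ^ m) + -(α m • G (Polynomial.X ^ m) +
        γ m • G (Polynomial.X ^ (m - 1))) := by
  have := LinearMap.congr_fun h (Polynomial.X ^ m)
  rw [Module.End.mul_apply, Module.End.mul_apply, hU, map_add, map_add, map_smul, map_smul,
    mulX_apply] at this
  rw [this]
  abel

theorem monic_of_mulX_mul_eq {G U : Op} {α γ : ℕ → ℂ}
    (hU : ∀ m : ℕ, U (Polynomial.X ^ m) =
      Polynomial.X ^ (m + 1) + α m • Polynomial.X ^ m + γ m • Polynomial.X ^ (m - 1))
    (h1 : G 1 = 1) (h : mulX * G = G * U) (n : ℕ) :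
    (G (Polynomial.X ^ n)).Monic ∧ (G (Polynomial.X ^ n)).natDegree = n := by
  induction n using Nat.strong_induction_on with
  | _ n ih =>
    rcases n with _ | m
    · simp [h1]
    obtain ⟨hm, hd⟩ := ih m (Nat.lt_succ_self m)
    -- For `m = 0` the truncated `m - 1` is `0`; the last term of the recurrence is then a multiple
    -- of `G 1`, and the degree bound still holds.
    obtain ⟨hm', hd'⟩ := ih (m - 1) (by omega)
    have hX : (Polynomial.X * G (Polynomial.X ^ m)).Monic := Polynomial.monic_X.mul hm
    have hXd : (Polynomial.X * G (Polynomial.X ^ m)).natDegree = m + 1 := by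
      rw [Polynomial.natDegree_X_mul hm.ne_zero, hd]
    have hlow : (-(α m • G (Polynomial.X ^ m) +
        γ m • G (Polynomial.X ^ (m - 1)))).natDegree < m + 1 := by
      rw [Polynomial.natDegree_neg]
      refine lt_of_le_of_lt (Polynomial.natDegree_add_le _ _) (max_lt ?_ ?_)
      · exact lt_of_le_of_lt (Polynomial.natDegree_smul_le _ _) (by omega)
      · exact lt_of_le_of_lt (Polynomial.natDegree_smul_le _ _) (by omega)
    have hlt : (-(α m • G (Polynomial.X ^ m) + γ m • G (Polynomial.X ^ (m - 1)))).degree <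
        (Polynomial.X * G (Polynomial.X ^ m)).degree :=
      Polynomial.degree_lt_degree (by rw [hXd]; exact hlow)
    rw [apply_X_pow_succ hU h]
    exact ⟨hX.add_of_left hlt, by
      rw [Polynomial.natDegree_add_eq_left_of_natDegree_lt (by rw [hXd]; exact hlow), hXd]⟩

/-- This removes inverses and degrees from the definition: the intertwining relation and the
normalization at `1` carry all the information. -/
theorem isFamilyOperator_iff {G U : Op} {α γ : ℕ → ℂ}
    (hU : ∀ m : ℕ, U (Polynomial.X ^ m) =
      Polynomial.X ^ (m + 1) + α m • Polynomial.X ^ m + γ m • Polynomial.X ^ (m - 1)) :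
    IsFamilyOperator G U ↔ G 1 = 1 ∧ mulX * G = G * U := by
  constructor
  · rintro ⟨hG, hu, h⟩
    refine ⟨?_, ?_⟩
    · have h0 := hG 0
      rw [pow_zero] at h0
      exact (h0.1.natDegree_eq_zero).mp h0.2
    · rw [mul_assoc] at h
      exact (Ring.inverse_mul_eq_iff_eq_mul _ _ _ hu).mp h
  · rintro ⟨h1, h⟩
    have hG := monic_of_mulX_mul_eq hU h1 h
    refine ⟨hG, isUnit_of_natDegree hG, ?_⟩
    rw [mul_assoc]
    exact (Ring.inverse_mul_eq_iff_eq_mul _ _ _ (isUnit_of_natDegree hG)).mpr h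

theorem eq_of_mulX_mul_eq {G G' U : Op} {α γ : ℕ → ℂ}
    (hU : ∀ m : ℕ, U (Polynomial.X ^ m) =
      Polynomial.X ^ (m + 1) + α m • Polynomial.X ^ m + γ m • Polynomial.X ^ (m - 1))
    (h1 : G 1 = 1) (h : mulX * G = G * U) (h1' : G' 1 = 1) (h' : mulX * G' = G' * U) :
    G = G' := by
  refine op_ext fun n => ?_
  induction n using Nat.strong_induction_on with
  | _ n ih =>
    rcases n with _ | m
    · rw [pow_zero, h1, h1']
    · rw [apply_X_pow_succ hU h, apply_X_pow_succ hU h', ih m (Nat.lt_succ_self m),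
        ih (m - 1) (by omega)]

/-! ### The operator `tildeC` -/

theorem mulX_sub_diag_X_pow (l : ℕ → ℂ) (m : ℕ) : (mulX - diag l) (Polynomial.X ^ m) =
    (Polynomial.X : ℂ[X]) ^ (m + 1) + (-l m) • Polynomial.X ^ m +
      (0 : ℂ) • Polynomial.X ^ (m - 1) := by
  rw [LinearMap.sub_apply, mulX_apply, diag_X_pow, zero_smul, add_zero, neg_smul, ← pow_succ',
    sub_eq_add_neg]

theorem tildeC_one (l : ℕ → ℂ) : tildeC l 1 = 1 := by
  rw [← pow_zero (Polynomial.X : ℂ[X]), tildeC, ofMonomials_X_pow, Finset.prod_range_zero, pow_zero]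

theorem mulX_mul_tildeC (l : ℕ → ℂ) : mulX * tildeC l = tildeC l * (mulX - diag l) := by
  refine op_ext fun n => ?_
  rw [Module.End.mul_apply, Module.End.mul_apply, LinearMap.sub_apply, map_sub, mulX_apply,
    mulX_apply, diag_X_pow, map_smul, ← pow_succ', tildeC, ofMonomials_X_pow, ofMonomials_X_pow,
    Finset.prod_range_succ, Polynomial.smul_eq_C_mul]
  ring

theorem isFamilyOperator_tildeC (l : ℕ → ℂ) : IsFamilyOperator (tildeC l) (mulX - diag l) :=
  (isFamilyOperator_iff (mulX_sub_diag_X_pow l)).mpr ⟨tildeC_one l, mulX_mul_tildeC l⟩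

theorem eq_tildeC_iff (l : ℕ → ℂ) (T : Op) :
    (IsUnit T ∧ T 1 = 1 ∧ Ring.inverse T * mulX * T = mulX - diag l) ↔ T = tildeC l := by
  constructor
  · rintro ⟨hu, h1, h⟩
    rw [mul_assoc, Ring.inverse_mul_eq_iff_eq_mul _ _ _ hu] at h
    exact eq_of_mulX_mul_eq (mulX_sub_diag_X_pow l) h1 h (tildeC_one l) (mulX_mul_tildeC l)
  · rintro rfl
    have h := isFamilyOperator_tildeC l
    exact ⟨h.2.1, tildeC_one l, h.2.2⟩

/-! ### The transpose of the inverse of `tildeC`. -/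

theorem coeff_sdiag_bar (T : Op) (l : ℂ⟦X⟧) (n : ℕ) :
    PowerSeries.coeff n (sdiag (fun m => (m.factorial : ℂ)) (bar T l)) =
      pairing l (T (Polynomial.X ^ n)) := by
  rw [sdiag, PowerSeries.coeff_mk, coeff_bar, mul_inv_cancel_left₀ (factorial_cast_ne_zero n)]

theorem sdiag_X_pow (h : ℕ → ℂ) (n : ℕ) :
    sdiag h (PowerSeries.X ^ n) = h n • (PowerSeries.X : ℂ⟦X⟧) ^ n := by
  ext k
  rw [sdiag, PowerSeries.coeff_mk, PowerSeries.coeff_smul, PowerSeries.coeff_X_pow, smul_eq_mul]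
  split_ifs with e
  · rw [e]
  · simp

theorem pairing_smul (a : ℂ) (l : ℂ⟦X⟧) (p : ℂ[X]) : pairing (a • l) p = a * pairing l p := by
  have : pairing (a • l) = a • pairing l := by
    refine op_ext fun n => ?_
    rw [LinearMap.smul_apply, pairing_X_pow, pairing_X_pow, PowerSeries.coeff_smul, smul_eq_mul,
      smul_eq_mul]
    ring
  rw [this, LinearMap.smul_apply, smul_eq_mul]

theorem sdiag_bar_sdiag_X_pow (T : Op) (n : ℕ) :
    sdiag (fun m => (m.factorial : ℂ))
      (bar T (sdiag (fun m => (m.factorial : ℂ)⁻¹) ((PowerSeries.X : ℂ⟦X⟧) ^ n))) =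
    PowerSeries.mk fun k => (T (Polynomial.X ^ k)).coeff n := by
  ext k
  rw [coeff_sdiag_bar, PowerSeries.coeff_mk, sdiag_X_pow, pairing_smul, pairing_series_X_pow,
    inv_mul_cancel_left₀ (factorial_cast_ne_zero n)]

theorem inverse_tildeC_apply_X_pow_succ (l : ℕ → ℂ) (k : ℕ) :
    Ring.inverse (tildeC l) (Polynomial.X ^ (k + 1)) =
      Polynomial.X * Ring.inverse (tildeC l) (Polynomial.X ^ k) -
        diag l (Ring.inverse (tildeC l) (Polynomial.X ^ k)) := by
  have hu := (isFamilyOperator_tildeC l).2.1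
  have h := (isFamilyOperator_tildeC l).2.2
  have h' : Ring.inverse (tildeC l) * mulX = (mulX - diag l) * Ring.inverse (tildeC l) := by
    rw [← h, Ring.mul_inverse_cancel_right _ _ hu]
  have := LinearMap.congr_fun h' (Polynomial.X ^ k)
  rwa [Module.End.mul_apply, Module.End.mul_apply, LinearMap.sub_apply, mulX_apply, mulX_apply,
    ← pow_succ'] at this

theorem inverse_tildeC_one (l : ℕ → ℂ) : Ring.inverse (tildeC l) 1 = 1 := by
  have h := Ring.inverse_mul_cancel _ (isFamilyOperator_tildeC l).2.1
  conv_lhs => rw [← tildeC_one l]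
  rw [← Module.End.mul_apply, h, Module.End.one_apply]

/-- Conjugation by factorials turns the transpose into the plain transposed matrix, so the left side
is the generating function `F n` of row `n` of the inverse. The relation `C⁻¹ x = (x - ℓ_θ) C⁻¹`
becomes `(1 + ℓ_{n+1} y) F (n+1) = y F n`, with `(1 + ℓ_0 y) F 0 = 1`. -/
theorem sdiag_bar_inverse_tildeC (l : ℕ → ℂ) (n : ℕ) :
    sdiag (fun m => (m.factorial : ℂ))
      (bar (Ring.inverse (tildeC l))
        (sdiag (fun m => (m.factorial : ℂ)⁻¹) ((PowerSeries.X : ℂ⟦X⟧) ^ n))) =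
    (PowerSeries.X : ℂ⟦X⟧) ^ n *
      (∏ k ∈ Finset.range (n + 1), (1 + PowerSeries.C (l k) * PowerSeries.X))⁻¹ := by
  rw [sdiag_bar_sdiag_X_pow]
  set F : ℕ → ℂ⟦X⟧ := fun n =>
    PowerSeries.mk fun k => (Ring.inverse (tildeC l) (Polynomial.X ^ k)).coeff n with hF
  have h0 : F 0 * (1 + PowerSeries.C (l 0) * PowerSeries.X) = 1 := by
    rw [mul_add, mul_one, mul_left_comm]
    ext k
    rcases k with _ | k
    · simp [hF, inverse_tildeC_one]
    · rw [map_add, PowerSeries.coeff_C_mul, PowerSeries.coeff_succ_mul_X]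
      simp only [hF, PowerSeries.coeff_mk]
      rw [inverse_tildeC_apply_X_pow_succ, Polynomial.coeff_sub, coeff_diag]
      simp [PowerSeries.coeff_one]
  have hs : ∀ n, F (n + 1) * (1 + PowerSeries.C (l (n + 1)) * PowerSeries.X) =
      F n * PowerSeries.X := by
    intro n
    rw [mul_add, mul_one, mul_left_comm]
    ext k
    rcases k with _ | k
    · simp [hF, inverse_tildeC_one, Polynomial.coeff_one]
    · rw [map_add, PowerSeries.coeff_C_mul, PowerSeries.coeff_succ_mul_X,
        PowerSeries.coeff_succ_mul_X]
      simp only [hF, PowerSeries.coeff_mk]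
      rw [inverse_tildeC_apply_X_pow_succ, Polynomial.coeff_sub, coeff_diag,
        Polynomial.coeff_X_mul]
      ring
  have hn : F n * ∏ k ∈ Finset.range (n + 1), (1 + PowerSeries.C (l k) * PowerSeries.X) =
      PowerSeries.X ^ n := by
    induction n with
    | zero => simpa using h0
    | succ n ih =>
      rw [Finset.prod_range_succ, mul_left_comm, hs, pow_succ, ← ih]
      ring
  rw [PowerSeries.eq_mul_inv_iff_mul_eq]
  · exact hn
  · simp [map_prod]

/-! ### The operators `θ! l(D) θ!⁻¹` -/

/-- The operator `θ! l(D) θ!⁻¹`. -/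
noncomputable def conjSerD (l : ℂ⟦X⟧) : Op :=
  diag (fun n => (n.factorial : ℂ)) * serD l * diag (fun n => (n.factorial : ℂ)⁻¹)

theorem conj_serD_X_pow (l : ℂ⟦X⟧) (n : ℕ) :
    conjSerD l
      (Polynomial.X ^ n) = ∑ k ∈ Finset.range (n + 1),
        PowerSeries.coeff k l • (Polynomial.X : ℂ[X]) ^ (n - k) := by
  rw [conjSerD, Module.End.mul_apply, Module.End.mul_apply, diag_X_pow, map_smul, map_smul,
    serD_X_pow, map_sum, Finset.smul_sum]
  refine Finset.sum_congr rfl fun k hk => ?_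
  have hkn : k ≤ n := Nat.lt_succ_iff.mp (Finset.mem_range.mp hk)
  have hd : ((n - k).factorial : ℂ) * n.descFactorial k = n.factorial := by
    exact_mod_cast Nat.factorial_mul_descFactorial hkn
  have hn := factorial_cast_ne_zero n
  rw [map_smul, diag_X_pow, smul_smul, smul_smul]
  congr 1
  field_simp
  linear_combination PowerSeries.coeff k l * hd

/-- Since `θ! D θ!⁻¹` sends `x^n` to `x^(n-1)` and kills `1`, it commutes with `x` except for the
constant term. Hence `conjSerD l x^(n+1)` exceeds `x · conjSerD l x^n` only by its last summand, a
constant. -/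
theorem mulX_mul_conj_serD (l : ℂ⟦X⟧) :
    mulX * conjSerD l =
      conjSerD l * mulX -
        ofMonomials fun n => Polynomial.C (PowerSeries.coeff (n + 1) l) := by
  refine op_ext fun n => ?_
  rw [LinearMap.sub_apply, Module.End.mul_apply, Module.End.mul_apply, mulX_apply, mulX_apply,
    ← pow_succ', conj_serD_X_pow, conj_serD_X_pow, ofMonomials_X_pow,
    Finset.sum_range_succ _ (n + 1), Nat.sub_self, pow_zero, Finset.mul_sum,
    Polynomial.smul_eq_C_mul, mul_one, add_sub_cancel_right]
  refine Finset.sum_congr rfl fun k hk => ?_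
  have hkn : k ≤ n := Nat.lt_succ_iff.mp (Finset.mem_range.mp hk)
  rw [Nat.sub_add_comm hkn, pow_succ', mul_smul_comm]

/-- Writing a functional into the constants as a pairing lets it be moved by transposition. -/
theorem ofMonomials_C_apply (u : ℕ → ℂ) (p : ℂ[X]) :
    (ofMonomials fun n => Polynomial.C (u n)) p =
      Polynomial.C (pairing (PowerSeries.mk fun n => (n.factorial : ℂ)⁻¹ * u n) p) := by
  have : (ofMonomials fun n => Polynomial.C (u n)) = (Algebra.linearMap ℂ ℂ[X]) ∘ₗ
      pairing (PowerSeries.mk fun n => (n.factorial : ℂ)⁻¹ * u n) := by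
    refine op_ext fun n => ?_
    rw [ofMonomials_X_pow, LinearMap.comp_apply, pairing_X_pow, PowerSeries.coeff_mk,
      mul_inv_cancel_left₀ (factorial_cast_ne_zero n)]
    rfl
  exact LinearMap.congr_fun this p


/-! ### Binomial series -/

theorem falling_zero (z : ℂ) : falling z 0 = 1 := by simp [falling]

theorem falling_succ (z : ℂ) (n : ℕ) : falling z (n + 1) = falling z n * (z - n) :=
  descPochhammer_succ_eval n z

theorem falling_succ_left (z : ℂ) (n : ℕ) : falling z (n + 1) = z * falling (z - 1) n := by
  simp [falling, descPochhammer_succ_left, Polynomial.eval_comp]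

/-- The series `(1 + b y) ^ t`. -/
noncomputable def binomPow (b t : ℂ) : ℂ⟦X⟧ :=
  PowerSeries.mk fun n => b ^ n * falling t n / n.factorial

theorem coeff_binomPow (b t : ℂ) (n : ℕ) :
    PowerSeries.coeff n (binomPow b t) = b ^ n * falling t n / n.factorial :=
  PowerSeries.coeff_mk _ _

theorem coeff_one_add_mul_derivative (b : ℂ) (g : ℂ⟦X⟧) (n : ℕ) :
    PowerSeries.coeff n ((1 + PowerSeries.C b * PowerSeries.X) * PowerSeries.derivative ℂ g) =
      PowerSeries.coeff (n + 1) g * (n + 1) + b * n * PowerSeries.coeff n g := by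
  rw [add_mul, one_mul, map_add, mul_assoc, PowerSeries.coeff_C_mul, PowerSeries.coeff_derivative]
  rcases n with _ | n
  · simp
  · rw [PowerSeries.coeff_succ_X_mul, PowerSeries.coeff_derivative]
    push_cast
    ring

theorem constantCoeff_binomPow (b t : ℂ) : PowerSeries.constantCoeff (binomPow b t) = 1 := by
  rw [← PowerSeries.coeff_zero_eq_constantCoeff_apply, coeff_binomPow]
  simp [falling_zero]

theorem derivative_binomPow (b t : ℂ) :
    (1 + PowerSeries.C b * PowerSeries.X) * PowerSeries.derivative ℂ (binomPow b t) =
      PowerSeries.C (t * b) * binomPow b t := by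
  ext n
  have h1 : (n : ℂ) + 1 ≠ 0 := Nat.cast_add_one_ne_zero n
  have h2 := factorial_cast_ne_zero n
  rw [coeff_one_add_mul_derivative, PowerSeries.coeff_C_mul, coeff_binomPow, coeff_binomPow,
    falling_succ, Nat.factorial_succ]
  push_cast
  field_simp
  ring

/-- The differential equation is a first-order recursion for the coefficients. It replaces binomial
identities in the proofs of the power laws below. -/
theorem eq_binomPow {b t : ℂ} {g : ℂ⟦X⟧} (h0 : PowerSeries.constantCoeff g = 1)
    (h : (1 + PowerSeries.C b * PowerSeries.X) * PowerSeries.derivative ℂ g =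
      PowerSeries.C (t * b) * g) : g = binomPow b t := by
  ext n
  induction n with
  | zero =>
    rw [PowerSeries.coeff_zero_eq_constantCoeff_apply, h0,
      PowerSeries.coeff_zero_eq_constantCoeff_apply, constantCoeff_binomPow]
  | succ n ih =>
    have h1 : (n : ℂ) + 1 ≠ 0 := Nat.cast_add_one_ne_zero n
    have e1 := congrArg (PowerSeries.coeff n) h
    have e2 := congrArg (PowerSeries.coeff n) (derivative_binomPow b t)
    rw [coeff_one_add_mul_derivative, PowerSeries.coeff_C_mul] at e1 e2
    refine mul_right_cancel₀ h1 ?_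
    linear_combination e1 - e2 + (t * b - b * n) * ih

theorem binomPow_add (b t u : ℂ) : binomPow b t * binomPow b u = binomPow b (t + u) := by
  refine eq_binomPow ?_ ?_
  · rw [map_mul, constantCoeff_binomPow, constantCoeff_binomPow, one_mul]
  · rw [Derivation.leibniz, smul_eq_mul, smul_eq_mul, add_mul t u b, map_add]
    linear_combination binomPow b t * derivative_binomPow b u +
      binomPow b u * derivative_binomPow b t

theorem binomPow_zero (b : ℂ) : binomPow b 0 = 1 :=
  (eq_binomPow (by simp) (by simp)).symm

theorem binomPow_two (b : ℂ) : binomPow b 2 = (1 + PowerSeries.C b * PowerSeries.X) ^ 2 := by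
  refine (eq_binomPow (by simp) ?_).symm
  rw [Derivation.leibniz_pow, map_add, Derivation.map_one_eq_zero, Derivation.leibniz,
    PowerSeries.derivative_C, PowerSeries.derivative_X, map_mul]
  simp only [smul_eq_mul, nsmul_eq_mul, map_ofNat]
  push_cast
  ring

theorem binomPow_pow (b t : ℂ) (n : ℕ) : binomPow b t ^ n = binomPow b (n * t) := by
  induction n with
  | zero => simp [binomPow_zero]
  | succ n ih =>
    rw [pow_succ, ih, binomPow_add]
    push_cast
    ring_nf

theorem binomialSeries_eq_binomPow (t : ℂ) : PowerSeries.binomialSeries ℂ t = binomPow 1 t := by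
  ext n
  have h := Ring.descPochhammer_eq_factorial_smul_choose t n
  rw [PowerSeries.binomialSeries_coeff, coeff_binomPow, falling, one_pow, one_mul,
    eq_div_iff (factorial_cast_ne_zero n)]
  rw [← descPochhammer_map (algebraMap ℤ ℂ) n, Polynomial.eval_map_algebraMap,
    Polynomial.aeval_eq_smeval, h]
  simp [mul_comm]

theorem derivative_binomialSeries (t : ℂ) : (1 + PowerSeries.X) *
    PowerSeries.derivative ℂ (PowerSeries.binomialSeries ℂ t) =
      PowerSeries.C t * PowerSeries.binomialSeries ℂ t := by
  simpa [binomialSeries_eq_binomPow] using derivative_binomPow 1 t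

/-! ### Complex powers `cpow` and their behaviour under substitution. -/

theorem hasSubst_sub_one {g : ℂ⟦X⟧} (hg : PowerSeries.constantCoeff g = 1) :
    PowerSeries.HasSubst (g - 1) :=
  PowerSeries.HasSubst.of_constantCoeff_zero' (by simp [hg])

theorem constantCoeff_subst_of_zero {φ : ℂ⟦X⟧} (hφ : PowerSeries.constantCoeff φ = 0) (l : ℂ⟦X⟧) :
    PowerSeries.constantCoeff (l.subst φ) = PowerSeries.constantCoeff l := by
  rw [← PowerSeries.coeff_zero_eq_constantCoeff_apply, coeff_subst_eq_sum_range hφ]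
  simp

theorem constantCoeff_cpow {g : ℂ⟦X⟧} (hg : PowerSeries.constantCoeff g = 1) (t : ℂ) :
    PowerSeries.constantCoeff (cpow g t) = 1 := by
  rw [cpow, constantCoeff_subst_of_zero (by simp [hg]), binomialSeries_eq_binomPow,
    constantCoeff_binomPow]

theorem subst_one' {φ : ℂ⟦X⟧} (hφ : PowerSeries.HasSubst φ) : (1 : ℂ⟦X⟧).subst φ = 1 := by
  rw [← PowerSeries.coe_substAlgHom hφ, map_one]

theorem subst_C' {φ : ℂ⟦X⟧} (hφ : PowerSeries.HasSubst φ) (a : ℂ) :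
    (PowerSeries.C a).subst φ = PowerSeries.C a := by
  rw [← PowerSeries.coe_substAlgHom hφ]
  exact (PowerSeries.substAlgHom hφ).commutes a

theorem derivative_cpow {g : ℂ⟦X⟧} (hg : PowerSeries.constantCoeff g = 1) (t : ℂ) :
    g * PowerSeries.derivative ℂ (cpow g t) =
      PowerSeries.C t * PowerSeries.derivative ℂ g * cpow g t := by
  have hs := hasSubst_sub_one hg
  have h := congrArg (PowerSeries.subst (g - 1)) (derivative_binomialSeries t)
  rw [PowerSeries.subst_mul hs, PowerSeries.subst_mul hs, PowerSeries.subst_add hs,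
    subst_one' hs, PowerSeries.subst_X hs, subst_C' hs] at h
  rw [cpow, PowerSeries.derivative_subst hs, map_sub, Derivation.map_one_eq_zero, sub_zero]
  linear_combination PowerSeries.derivative ℂ g * h

theorem cpow_subst {g φ : ℂ⟦X⟧} (hg : PowerSeries.constantCoeff g = 1)
    (hφ : PowerSeries.constantCoeff φ = 0) (t : ℂ) :
    (cpow g t).subst φ = cpow (g.subst φ) t := by
  have sφ := PowerSeries.HasSubst.of_constantCoeff_zero' hφ
  rw [cpow, PowerSeries.subst_comp_subst_apply (hasSubst_sub_one hg) sφ,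
    PowerSeries.subst_sub sφ, subst_one' sφ, cpow]

theorem one_add_C_mul_X_ne_zero (b : ℂ) : (1 + PowerSeries.C b * PowerSeries.X : ℂ⟦X⟧) ≠ 0 :=
  fun h => by simpa using congrArg PowerSeries.constantCoeff h

theorem cpow_binomPow_two (b t : ℂ) : cpow (binomPow b 2) t = binomPow b (2 * t) := by
  refine eq_binomPow (constantCoeff_cpow (constantCoeff_binomPow b 2) t) ?_
  have h := derivative_cpow (constantCoeff_binomPow b 2) t
  have h2 := derivative_binomPow b 2
  -- Two factors `1 + b y` are inserted because the differential equation of `cpow g t` carries the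
  -- coefficient `g = (1 + b y)^2`.
  refine mul_left_cancel₀ (one_add_C_mul_X_ne_zero b) ?_
  refine mul_left_cancel₀ (one_add_C_mul_X_ne_zero b) ?_
  rw [map_mul] at h2
  rw [map_mul, map_mul]
  rw [binomPow_two] at *
  linear_combination (1 + PowerSeries.C b * PowerSeries.X) * h +
    PowerSeries.C t * cpow ((1 + PowerSeries.C b * PowerSeries.X) ^ 2) t * h2

theorem binomPow_one (b : ℂ) :
    binomPow b 1 = 1 + PowerSeries.C b * PowerSeries.X := by
  refine (eq_binomPow (by simp) ?_).symm
  rw [map_add, Derivation.map_one_eq_zero, Derivation.leibniz,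
    PowerSeries.derivative_C, PowerSeries.derivative_X, one_mul]
  simp only [smul_eq_mul]
  ring

theorem zeroDeriv_mul_X (g : ℂ⟦X⟧) :
    zeroDeriv g * PowerSeries.X = g - PowerSeries.C (PowerSeries.constantCoeff g) := by
  ext k
  rcases k with _ | k
  · simp
  · rw [PowerSeries.coeff_succ_mul_X, zeroDeriv, PowerSeries.coeff_mk, map_sub,
      PowerSeries.coeff_C, if_neg (Nat.succ_ne_zero k), sub_zero]

/-! ### The series `f` -/

theorem compInv_eq {f φ : ℂ⟦X⟧} (h0 : PowerSeries.constantCoeff f = 0)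
    (h1 : PowerSeries.coeff 1 f ≠ 0) (hφ : PowerSeries.constantCoeff φ = 0)
    (h : f.subst φ = PowerSeries.X) : compInv f = φ := by
  have sf := PowerSeries.HasSubst.of_constantCoeff_zero' h0
  have sφ := PowerSeries.HasSubst.of_constantCoeff_zero' hφ
  have e := congrArg (PowerSeries.subst φ) (compInv_subst f h0 h1)
  rwa [PowerSeries.subst_comp_subst_apply sf sφ, h, PowerSeries.X_subst,
    PowerSeries.subst_X sφ] at e

namespace Params

/-- The constant `λ a / 2`. -/
noncomputable def b (P : Params) : ℂ := P.lam * P.a / 2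

theorem f_mul (P : Params) : P.f * (1 - PowerSeries.C P.b * PowerSeries.X) = PowerSeries.X := by
  rw [f, b, mul_assoc, PowerSeries.inv_mul_cancel _ (by simp), mul_one]

theorem constantCoeff_f (P : Params) : PowerSeries.constantCoeff P.f = 0 := by
  simp [f]

theorem coeff_one_f (P : Params) : PowerSeries.coeff 1 P.f = 1 := by
  rw [f, PowerSeries.coeff_one_mul]
  simp

theorem constantCoeff_df (P : Params) : PowerSeries.constantCoeff P.df = 1 := by
  rw [df, df_eq]
  simp [constantCoeff_f]

/-- The functional inverse of `f`. -/
noncomputable def phi (P : Params) : ℂ⟦X⟧ := PowerSeries.X * binomPow P.b (-1)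

theorem constantCoeff_phi (P : Params) : PowerSeries.constantCoeff P.phi = 0 := by
  simp [phi]

theorem hasSubst_phi (P : Params) : PowerSeries.HasSubst P.phi :=
  PowerSeries.HasSubst.of_constantCoeff_zero' P.constantCoeff_phi

theorem phi_mul (P : Params) :
    P.phi * (1 + PowerSeries.C P.b * PowerSeries.X) = PowerSeries.X := by
  rw [phi, ← binomPow_one, mul_assoc, binomPow_add, neg_add_cancel, binomPow_zero, mul_one]

theorem f_subst_phi (P : Params) : P.f.subst P.phi = PowerSeries.X := by
  have hs := P.hasSubst_phi
  have h := congrArg (PowerSeries.subst P.phi) P.f_mul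
  rw [PowerSeries.subst_mul hs, PowerSeries.subst_sub hs, PowerSeries.subst_mul hs,
    subst_one' hs, subst_C' hs, PowerSeries.subst_X hs] at h
  have h2 := P.phi_mul
  linear_combination (1 + PowerSeries.C P.b * PowerSeries.X) * h +
    (PowerSeries.C P.b * P.f.subst P.phi + 1) * h2

theorem compInv_f (P : Params) : compInv P.f = P.phi :=
  compInv_eq P.constantCoeff_f (by rw [coeff_one_f]; exact one_ne_zero) P.constantCoeff_phi
    P.f_subst_phi

theorem df_subst_phi (P : Params) : P.df.subst P.phi = binomPow P.b 2 := by
  have hs := P.hasSubst_phi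
  rw [df, df_eq, PowerSeries.subst_pow hs, PowerSeries.subst_add hs, PowerSeries.subst_mul hs,
    subst_one' hs, subst_C' hs, f_subst_phi, binomPow_two, b]

theorem frakT_mul (P : Params) : frakT P.f * P.df = P.f := by
  rw [frakT, mul_assoc, ← df, PowerSeries.inv_mul_cancel _ (by simp [constantCoeff_df]), mul_one]

theorem constantCoeff_frakT (P : Params) : PowerSeries.constantCoeff (frakT P.f) = 0 := by
  simp [frakT, constantCoeff_f]

theorem coeff_one_frakT (P : Params) : PowerSeries.coeff 1 (frakT P.f) = 1 := by
  have h := congrArg (PowerSeries.coeff 1) P.frakT_mul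
  rw [PowerSeries.coeff_one_mul, coeff_one_f] at h
  simpa [constantCoeff_df, constantCoeff_frakT] using h

theorem hasSubst_frakT (P : Params) : PowerSeries.HasSubst (frakT P.f) :=
  PowerSeries.HasSubst.of_constantCoeff_zero' P.constantCoeff_frakT

theorem frakT_subst_phi (P : Params) :
    (frakT P.f).subst P.phi = PowerSeries.X * binomPow P.b (-2) := by
  have h := congrArg (PowerSeries.subst P.phi) P.frakT_mul
  rw [PowerSeries.subst_mul P.hasSubst_phi, df_subst_phi, f_subst_phi] at h
  have h2 : binomPow P.b 2 * binomPow P.b (-2) = 1 := by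
    rw [binomPow_add, add_neg_cancel, binomPow_zero]
  linear_combination binomPow P.b (-2) * h - (frakT P.f).subst P.phi * h2

theorem constantCoeff_omega (P : Params) : PowerSeries.constantCoeff P.omega = 0 :=
  constantCoeff_compInv _

theorem constantCoeff_df_subst_omega (P : Params) :
    PowerSeries.constantCoeff (P.df.subst P.omega) = 1 := by
  rw [constantCoeff_subst_of_zero P.constantCoeff_omega, constantCoeff_df]

/-- The substituted series is `(f/f') ∘ φ`. As `ω` inverts `f/f'`, the composite `ω ∘ (f/f') ∘ φ` is
`φ`, and `f' ∘ φ = (1 + b y)^2`. -/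
theorem cpow_omega_subst (P : Params) (t : ℂ) :
    (cpow (P.df.subst P.omega) t).subst ((PowerSeries.X : ℂ⟦X⟧) * binomPow P.b (-2)) =
      binomPow P.b (2 * t) := by
  have so := PowerSeries.HasSubst.of_constantCoeff_zero' P.constantCoeff_omega
  have e : P.omega.subst (frakT P.f) = PowerSeries.X :=
    compInv_subst _ P.constantCoeff_frakT (by rw [coeff_one_frakT]; exact one_ne_zero)
  rw [← frakT_subst_phi, ← PowerSeries.subst_comp_subst_apply P.hasSubst_frakT P.hasSubst_phi,
    cpow_subst P.constantCoeff_df_subst_omega P.constantCoeff_frakT,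
    PowerSeries.subst_comp_subst_apply so P.hasSubst_frakT, e, PowerSeries.X_subst,
    cpow_subst P.constantCoeff_df P.constantCoeff_phi, df_subst_phi, cpow_binomPow_two]

/-- The operator `C_{f/f'}⁻¹ f'(D) ^ t C_f`. -/
noncomputable def core (P : Params) (t : ℂ) : Op :=
  Ring.inverse (umbral (frakT P.f)) * serD (cpow P.df t) * umbral P.f

theorem bar_core (P : Params) (t : ℂ) (l : ℂ⟦X⟧) : bar (P.core t) l =
    binomPow P.b (2 * t) * l.subst ((PowerSeries.X : ℂ⟦X⟧) * binomPow P.b (-2)) := by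
  have h1 : umbral P.f = substOp P.phi := by rw [← compInv_f]; rfl
  rw [core, bar_mul, bar_mul, h1, bar_substOp P.constantCoeff_phi, bar_serD,
    inverse_umbral _ P.constantCoeff_frakT (by rw [coeff_one_frakT]; exact one_ne_zero),
    bar_substOp P.constantCoeff_frakT, PowerSeries.subst_mul P.hasSubst_phi,
    PowerSeries.subst_comp_subst_apply P.hasSubst_frakT P.hasSubst_phi, frakT_subst_phi,
    cpow_subst P.constantCoeff_df P.constantCoeff_phi, df_subst_phi, cpow_binomPow_two]

theorem hasSubst_X_mul_binomPow (b t : ℂ) :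
    PowerSeries.HasSubst ((PowerSeries.X : ℂ⟦X⟧) * binomPow b t) :=
  PowerSeries.HasSubst.of_constantCoeff_zero' (by simp)

theorem bar_core_X_pow (P : Params) (t : ℂ) (n : ℕ) : bar (P.core t) (PowerSeries.X ^ n) =
    PowerSeries.X ^ n * binomPow P.b (2 * t - 2 * n) := by
  have hs := hasSubst_X_mul_binomPow P.b (-2)
  rw [bar_core, PowerSeries.subst_pow hs, PowerSeries.subst_X hs, mul_pow, binomPow_pow,
    mul_left_comm, binomPow_add]
  ring_nf

/-- This is where the exponent in `s` comes from: the power `-t - 1` is the one for which the factor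
`(1+by)^(2t)` and the denominator `y(1+by)^(-2)` of the `0`-derivative combine to leave `1` as the
first term. For `t = -c - 1/λ` it equals `c - 1 + 1/λ`. -/
theorem bar_core_zeroDeriv (P : Params) (t : ℂ) :
    bar (P.core t) (zeroDeriv (cpow (P.df.subst P.omega) (-t - 1))) * PowerSeries.X =
      1 - binomPow P.b (2 * t + 2) := by
  have hs := hasSubst_X_mul_binomPow P.b (-2)
  have h := congrArg (PowerSeries.subst ((PowerSeries.X : ℂ⟦X⟧) * binomPow P.b (-2)))
    (zeroDeriv_mul_X (cpow (P.df.subst P.omega) (-t - 1)))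
  rw [PowerSeries.subst_mul hs, PowerSeries.subst_X hs, PowerSeries.subst_sub hs,
    constantCoeff_cpow P.constantCoeff_df_subst_omega, map_one, subst_one' hs,
    cpow_omega_subst] at h
  rw [bar_core]
  have e1 : binomPow P.b (-2) * binomPow P.b (2 * t + 2) = binomPow P.b (2 * t) := by
    rw [binomPow_add]
    ring_nf
  have e2 : binomPow P.b (2 * t + 2) * binomPow P.b (2 * (-t - 1)) = 1 := by
    rw [binomPow_add, ← binomPow_zero P.b]
    ring_nf
  rw [← e1]
  linear_combination binomPow P.b (2 * t + 2) * h + e2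


/-! ### The recurrence coefficients -/

/-- The numerator of `ratio`. -/
noncomputable def ratioNum (P : Params) (z : ℂ) : ℂ :=
  P.h * (1 + P.beta * z) * (1 + P.lam * (z + 1)) ^ 2 + (1 - P.h) * (1 + P.beta2 * z)

theorem ratio_mul (P : Params) {z : ℂ} (h1 : 1 + P.lam * z ≠ 0) (h2 : 1 + P.kap * z ≠ 0) :
    P.ratio z * ((1 + P.lam * z) * (1 + P.kap * z)) = P.ratioNum z :=
  div_mul_cancel₀ _ (mul_ne_zero h1 h2)

/-- With `λ = 1/L`, `κ = 2/M` and `z = y - L`, the factors become `1 + λz = y/L` and `1 + κz =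
(2y+1)/M`. The remaining identities then have denominators linear in `y`, and `M = 2L + 1` is the
only relation. -/
theorem exists_reparametrization {l q : ℂ} (hl : l ≠ 0) (hq : q ≠ 0)
    (h : 1 / q - 1 / l = 1 / 2) :
    ∃ L M : ℂ, L ≠ 0 ∧ M ≠ 0 ∧ M = 2 * L + 1 ∧ l = 1 / L ∧ q = 2 / M := by
  have e : 2 * (1 / l) + 1 = 2 / q := by linear_combination -2 * h
  have h2 : 2 * (1 / l) + 1 ≠ 0 := by rw [e]; exact div_ne_zero two_ne_zero hq
  refine ⟨1 / l, _, one_div_ne_zero hl, h2, rfl, by simp, ?_⟩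
  rw [e]
  field_simp

/-- The comparison of diagonal entries. It determines `A` as the difference of neighbouring
first-order coefficients, corrected by `ℓ`. -/
theorem wilson_recurrence_zero (P : Params) (hlam : P.lam ≠ 0) (hkap : P.kap ≠ 0)
    (hlk : 1 / P.kap - 1 / P.lam = 1 / 2) {z : ℂ} (h1 : 1 + P.lam * z ≠ 0)
    (h2 : 1 + P.kap * z ≠ 0)
    (h3 : z ≠ 0 → 1 + P.lam * (z - 1) ≠ 0 ∧ 1 + P.kap * (z - 1) ≠ 0) :
    P.b * (z * P.ratio (z - 1)) * (2 - 2 / P.lam - 2 * z) -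
      2 * P.a * P.h * P.lam ^ 2 * P.kap⁻¹ * (1 + z) * (1 + P.beta * z) =
    P.b * ((z + 1) * P.ratio z) * (-2 / P.lam - 2 * z) + P.wilsonA z := by
  obtain ⟨l, q, a, h, r, r2⟩ := P
  simp only at *
  obtain ⟨L, M, hL, hM, hML, rfl, rfl⟩ := exists_reparametrization hlam hkap hlk
  clear hlk hlam hkap
  obtain ⟨y, rfl⟩ : ∃ y, z = y - L := ⟨z + L, by ring⟩
  simp only [b, ratio, wilsonA, jacobiDiag, beta, beta2]
  have e1 : 1 + 1 / L * (y - L) = y / L := by field_simp; ring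
  have e2 : 1 + 2 / M * (y - L) = (2 * y + 1) / M := by field_simp; rw [hML]; ring
  have e4 : 1 + 1 / L * (y - L - 1) = (y - 1) / L := by field_simp; ring
  have e5 : 1 + 2 / M * (y - L - 1) = (2 * y - 1) / M := by field_simp; rw [hML]; ring
  have e6 : ∀ r : ℂ, r * (2 / M) + (1 - r) * (1 / L) =
      (M - r) / (L * M) := by intro r; field_simp; rw [hML]; ring
  rw [e6, e6]
  rw [e4, e5] at h3
  rw [e1] at h1
  rw [e2] at h2
  rw [e1, e2, e4, e5]
  have hy : y ≠ 0 := (div_ne_zero_iff.mp h1).1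
  have hy2 : 2 * y + 1 ≠ 0 := (div_ne_zero_iff.mp h2).1
  -- At `z = 0` the terms with index `z - 1` carry the factor `z` and vanish, so no condition on
  -- their denominators is needed.
  by_cases hz : y - L = 0
  · obtain rfl : y = L := sub_eq_zero.mp hz
    simp only [sub_self, zero_mul, mul_zero, zero_div, add_zero, zero_add]
    field_simp
    rw [hML]
    ring
  · have hy4 : y - 1 ≠ 0 := (div_ne_zero_iff.mp (h3 hz).1).1
    have hy5 : 2 * y - 1 ≠ 0 := (div_ne_zero_iff.mp (h3 hz).2).1
    clear e1 e2 e4 e5 h1 h2 h3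
    field_simp
    rw [hML]
    ring

/-- The comparison of entries at distance `k` above the diagonal, after the common binomial factor
is removed; here `z` is the column index and `z - k` the row index, both shifted by `c`. -/
theorem wilson_recurrence (P : Params) (hlam : P.lam ≠ 0) (hkap : P.kap ≠ 0)
    (hlk : 1 / P.kap - 1 / P.lam = 1 / 2) {z k e : ℂ} (he : e = -2 / P.lam - 2 * (z - k))
    (h1 : 1 + P.lam * z ≠ 0) (h2 : 1 + P.kap * z ≠ 0) (h5 : 1 + P.kap * (z - 1) ≠ 0)
    (h3 : z - k ≠ 0 → 1 + P.lam * (z - k - 1) ≠ 0 ∧ 1 + P.kap * (z - k - 1) ≠ 0) :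
    P.b ^ 2 * ((z - k) * P.ratio (z - k - 1)) * ((e + 2) * (e + 1)) -
      P.b * (2 * P.a * P.h * P.lam ^ 2 * P.kap⁻¹ * (1 + (z - k)) * (1 + P.beta * (z - k))) *
        ((e - k + 1) * (k + 1)) =
    P.b ^ 2 * ((z + 1) * P.ratio z) * ((e - k + 1) * (e - k)) +
      P.b * P.wilsonA z * ((e - k + 1) * (k + 1)) + P.wilsonLow (z - 1) * (k * (k + 1)) := by
  -- The factors `e + 2` and `e + 1` are multiples of the two denominators of the ratio at `z - k -
  -- 1`, so this term has no pole left.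
  have hX : (z - k) * P.ratio (z - k - 1) * ((e + 2) * (e + 1)) =
      (z - k) * (4 / (P.lam * P.kap)) * P.ratioNum (z - k - 1) := by
    by_cases hz : z - k = 0
    · rw [hz]; ring
    · obtain ⟨h6, h7⟩ := h3 hz
      have e2 : e + 2 = -2 / P.lam * (1 + P.lam * (z - k - 1)) := by
        rw [he]; field_simp; ring
      have e1 : e + 1 = -2 / P.kap * (1 + P.kap * (z - k - 1)) := by
        have : e + 1 = -2 / P.lam - 1 - 2 * (z - k - 1) := by rw [he]; ring
        rw [this, show -2 / P.lam - 1 = -2 / P.kap by linear_combination 2 * hlk]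
        field_simp
        ring
      rw [e1, e2, ← P.ratio_mul h6 h7]
      ring
  have : P.b ^ 2 * ((z - k) * P.ratio (z - k - 1)) * ((e + 2) * (e + 1)) =
      P.b ^ 2 * ((z - k) * (4 / (P.lam * P.kap)) * P.ratioNum (z - k - 1)) := by
    linear_combination P.b ^ 2 * hX
  rw [this]
  clear this hX h3
  obtain ⟨l, q, a, h, r, r2⟩ := P
  simp only at *
  obtain ⟨L, M, hL, hM, hML, rfl, rfl⟩ := exists_reparametrization hlam hkap hlk
  clear hlk hlam hkap
  obtain ⟨y, rfl⟩ : ∃ y, z = y - L := ⟨z + L, by ring⟩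
  simp only [b, ratio, wilsonA, wilsonLow, jacobiLow, jacobiDiag, beta, beta2, ratioNum]
  have e0 : e = 2 * k - 2 * y := by rw [he]; field_simp; ring
  have e1 : 1 + 1 / L * (y - L) = y / L := by field_simp; ring
  have e2 : 1 + 2 / M * (y - L) = (2 * y + 1) / M := by field_simp; rw [hML]; ring
  have e3 : y - L - 1 + 1 = y - L := by ring
  have e4 : 1 + 1 / L * (y - L - 1) = (y - 1) / L := by field_simp; ring
  have e5 : 1 + 2 / M * (y - L - 1) = (2 * y - 1) / M := by field_simp; rw [hML]; ring
  have e6 : ∀ r : ℂ, r * (2 / M) + (1 - r) * (1 / L) =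
      (M - r) / (L * M) := by intro r; field_simp; rw [hML]; ring
  rw [e6, e6]
  rw [e1] at h1
  rw [e2] at h2
  rw [e5] at h5
  have hy : y ≠ 0 := (div_ne_zero_iff.mp h1).1
  have hy2 : 2 * y + 1 ≠ 0 := (div_ne_zero_iff.mp h2).1
  have hy5 : 2 * y - 1 ≠ 0 := (div_ne_zero_iff.mp h5).1
  rw [e3, e1, e2, e4, e5, e0]
  clear e0 e1 e2 e3 e4 e5 h1 h2 h5 he
  field_simp
  rw [hML]
  ring


theorem coeff_row_zero (P : Params) (hlam : P.lam ≠ 0) (hkap : P.kap ≠ 0)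
    (hlk : 1 / P.kap - 1 / P.lam = 1 / 2) {z e : ℂ} (he : e = -2 / P.lam - 2 * z)
    (h1 : 1 + P.lam * z ≠ 0) (h2 : 1 + P.kap * z ≠ 0)
    (h3 : z ≠ 0 → 1 + P.lam * (z - 1) ≠ 0 ∧ 1 + P.kap * (z - 1) ≠ 0) :
    z * P.ratio (z - 1) * PowerSeries.coeff 1 (binomPow P.b (e + 2)) -
      2 * P.a * P.h * P.lam ^ 2 * P.kap⁻¹ * (1 + z) * (1 + P.beta * z) =
    (z + 1) * P.ratio z * PowerSeries.coeff 1 (binomPow P.b e) + P.wilsonA z := by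
  have h := P.wilson_recurrence_zero hlam hkap hlk h1 h2 h3
  have hf : ∀ t : ℂ, falling t 1 = t := fun t => by simp [falling]
  rw [coeff_binomPow, coeff_binomPow, hf, hf, he]
  simp only [pow_one, Nat.factorial_one, Nat.cast_one, div_one]
  linear_combination h

theorem coeff_row_succ (P : Params) (hlam : P.lam ≠ 0) (hkap : P.kap ≠ 0)
    (hlk : 1 / P.kap - 1 / P.lam = 1 / 2) {z w e : ℂ} {k : ℕ} (hw : z = w + (k + 1))
    (he : e = -2 / P.lam - 2 * w)
    (h1 : 1 + P.lam * z ≠ 0) (h2 : 1 + P.kap * z ≠ 0) (h5 : 1 + P.kap * (z - 1) ≠ 0)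
    (h3 : w ≠ 0 → 1 + P.lam * (w - 1) ≠ 0 ∧ 1 + P.kap * (w - 1) ≠ 0) :
    w * P.ratio (w - 1) * PowerSeries.coeff (k + 2) (binomPow P.b (e + 2)) -
      2 * P.a * P.h * P.lam ^ 2 * P.kap⁻¹ * (1 + w) * (1 + P.beta * w) *
        PowerSeries.coeff (k + 1) (binomPow P.b e) =
    (z + 1) * P.ratio z * PowerSeries.coeff (k + 2) (binomPow P.b e) +
      P.wilsonA z * PowerSeries.coeff (k + 1) (binomPow P.b e) +
      P.wilsonLow (z - 1) * PowerSeries.coeff k (binomPow P.b e) := by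
  have hw' : z - (k + 1) = w := by rw [hw]; ring
  have h := P.wilson_recurrence hlam hkap hlk (z := z) (k := k + 1) (e := e)
    (by rw [hw', he]) h1 h2 h5 (by rw [hw']; exact h3)
  rw [hw'] at h
  have c1 : (k : ℂ) + 1 ≠ 0 := Nat.cast_add_one_ne_zero k
  have c2 : (k : ℂ) + 1 + 1 ≠ 0 := by
    have := Nat.cast_add_one_ne_zero (R := ℂ) (k + 1)
    rwa [Nat.cast_succ] at this
  have ck := factorial_cast_ne_zero k
  simp only [coeff_binomPow]
  rw [falling_succ_left (e + 2) (k + 1), falling_succ_left (e + 2 - 1) k,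
    show e + 2 - 1 - 1 = e by ring, falling_succ e (k + 1), falling_succ e k, Nat.factorial_succ,
    Nat.factorial_succ]
  generalize P.kap⁻¹ = q at h ⊢
  push_cast
  field_simp
  linear_combination P.b ^ k * falling e k * h

/-! ### The entries of the conjugated core and its intertwining relation up to a defect. -/

theorem Regular.pred {P : Params} {c : ℂ} (hc : P.Regular c) (n : ℕ) (h : c + n ≠ 0) :
    1 + P.lam * (c + n - 1) ≠ 0 ∧ 1 + P.kap * (c + n - 1) ≠ 0 := by
  rcases n with _ | n
  · rw [Nat.cast_zero, add_zero] at h ⊢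
    exact hc.2 h
  · rw [Nat.cast_succ, ← add_assoc, add_sub_cancel_right]
    exact ⟨(hc.1 n).1, (hc.1 n).2.1⟩

theorem calH_ne_zero {P : Params} {c : ℂ} (hc : P.Regular c) (n : ℕ) : P.calH c n ≠ 0 :=
  Finset.prod_ne_zero_iff.mpr fun k _ => (hc.1 k).2.2.1

theorem falling_add_succ (c : ℂ) (n : ℕ) :
    falling (c + (n + 1 : ℕ)) (n + 1) = (c + n + 1) * falling (c + n) n := by
  rw [falling_succ_left]
  push_cast
  rw [← add_assoc, add_sub_cancel_right]

theorem falling_ne_zero {P : Params} {c : ℂ} (hc : P.Regular c) (n : ℕ) :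
    falling (c + n) n ≠ 0 := by
  induction n with
  | zero => rw [falling_zero]; exact one_ne_zero
  | succ n ih => rw [falling_add_succ]; exact mul_ne_zero (hc.1 n).2.2.2 ih

/-- The diagonal coefficients `(c+n)_n 𝓗_{c+n} / 𝓗_c`. -/
noncomputable def weight (P : Params) (c : ℂ) (n : ℕ) : ℂ := P.calH c n * falling (c + n) n

theorem weight_ne_zero {P : Params} {c : ℂ} (hc : P.Regular c) (n : ℕ) : P.weight c n ≠ 0 :=
  mul_ne_zero (calH_ne_zero hc n) (falling_ne_zero hc n)

theorem weight_succ (P : Params) (c : ℂ) (n : ℕ) :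
    P.weight c (n + 1) = P.weight c n * (P.ratio (c + n) * (c + n + 1)) := by
  rw [weight, weight, falling_add_succ, calH, Finset.prod_range_succ, ← calH]
  ring

/-- The operator `C_{f/f'}⁻¹ f'(D) ^ (-c-1/λ) C_f` conjugated by diagonal operators. -/
noncomputable def conjCore (P : Params) (c : ℂ) : Op :=
  diag (fun n => n.factorial / falling (c + n) n * (P.calH c n)⁻¹) * P.core (-c - 1 / P.lam) *
    diag (fun n => P.calH c n * (falling (c + n) n / n.factorial))

theorem assocG_eq (P : Params) (c : ℂ) : P.assocG c =
    conjSerD (P.s c) * P.C2 c * P.conjCore c := by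
  rw [assocG, conjSerD, conjCore, core,
    ← diag_mul_diag (fun n : ℕ => (n.factorial : ℂ) / falling (c + n) n)
    (fun n => (P.calH c n)⁻¹), ← diag_mul_diag (P.calH c)]
  simp only [mul_assoc]

theorem conjCore_X_pow (P : Params) (c : ℂ) (m : ℕ) : P.conjCore c (Polynomial.X ^ m) =
    (P.weight c m / m.factorial) •
      diag (fun n => n.factorial / falling (c + n) n * (P.calH c n)⁻¹)
        (P.core (-c - 1 / P.lam) (Polynomial.X ^ m)) := by
  rw [conjCore, Module.End.mul_apply, Module.End.mul_apply, diag_X_pow, map_smul, map_smul, weight,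
    mul_div_assoc]

theorem coeff_conjCore (P : Params) (c : ℂ) (m n : ℕ) :
    (P.conjCore c (Polynomial.X ^ m)).coeff n = P.weight c m / P.weight c n *
      PowerSeries.coeff m
        (PowerSeries.X ^ n * binomPow P.b (-2 / P.lam - 2 * (c + n))) := by
  have hm := factorial_cast_ne_zero m
  have hn := factorial_cast_ne_zero n
  rw [conjCore_X_pow, Polynomial.coeff_smul, coeff_diag, coeff_apply_X_pow, bar_core_X_pow,
    smul_eq_mul, show 2 * (-c - 1 / P.lam) - 2 * (n : ℂ) = -2 / P.lam - 2 * (c + n) by ring,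
    weight, weight]
  field_simp

theorem coeff_conjCore_add (P : Params) (c : ℂ) (n k : ℕ) :
    (P.conjCore c (Polynomial.X ^ (n + k))).coeff n = P.weight c (n + k) / P.weight c n *
      PowerSeries.coeff k (binomPow P.b (-2 / P.lam - 2 * (c + n))) := by
  rw [coeff_conjCore, add_comm n k, PowerSeries.coeff_X_pow_mul]

theorem coeff_conjCore_of_lt (P : Params) (c : ℂ) {m n : ℕ} (h : m < n) :
    (P.conjCore c (Polynomial.X ^ m)).coeff n = 0 := by
  rw [coeff_conjCore, PowerSeries.coeff_X_pow_mul', if_neg (by omega), mul_zero]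

/-- The subdiagonal coefficients of the associated dual raising operator. -/
noncomputable def lowCoeff (P : Params) (c : ℂ) (m : ℕ) : ℂ :=
  m * ((1 + c + (m - 1 : ℕ)) * P.wilsonB ((m - 1 : ℕ) + c + 1) / (1 + (m - 1 : ℕ)))

theorem lowCoeff_zero (P : Params) (c : ℂ) : P.lowCoeff c 0 = 0 := by simp [lowCoeff]

theorem lowCoeff_succ (P : Params) (c : ℂ) (m : ℕ) : P.lowCoeff c (m + 1) =
    (c + m + 1) * (P.wilsonLow (c + m) * P.ratio (c + m)) := by
  have h1 : (m : ℂ) + 1 ≠ 0 := Nat.cast_add_one_ne_zero m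
  have h2 : 1 + (m : ℂ) ≠ 0 := by rwa [add_comm]
  rw [lowCoeff, wilsonB, Nat.add_sub_cancel, add_sub_cancel_right, add_comm (m : ℂ) c]
  push_cast
  field_simp
  ring

theorem assocDualRaising_X_pow (P : Params) (c : ℂ) (m : ℕ) :
    assocDualRaising P.wilsonA P.wilsonB c (Polynomial.X ^ m) =
      (Polynomial.X : ℂ[X]) ^ (m + 1) + P.wilsonA (m + c) • (Polynomial.X : ℂ[X]) ^ m +
        P.lowCoeff c m • (Polynomial.X : ℂ[X]) ^ (m - 1) := by
  have hD := opD_pow_X_pow 1 m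
  rw [pow_one, Nat.descFactorial_one] at hD
  rw [assocDualRaising, LinearMap.add_apply, LinearMap.add_apply, mulX_apply, diag_X_pow,
    Module.End.mul_apply, hD, map_smul, diag_X_pow, smul_smul, ← pow_succ', lowCoeff]

/-- The functional by which the truncated operator fails to have a given dual raising operator. -/
noncomputable def defect (P : Params) (c : ℂ) (m : ℕ) : ℂ :=
  -(c * P.ratio (c - 1) * P.weight c m *
    PowerSeries.coeff (m + 1) (binomPow P.b (-2 / P.lam - 2 * c + 2)))

/-- The first summand is the entry of `V` in row `n - 1`, column `n + k`, rewritten with the weight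
of row `n`. In this form it also makes sense for `n = 0`, where no such row exists. -/
theorem row_identity {P : Params} (hlam : P.lam ≠ 0) (hkap : P.kap ≠ 0)
    (hlk : 1 / P.kap - 1 / P.lam = 1 / 2) {c : ℂ} (hc : P.Regular c) (n k : ℕ) :
    (c + n) * P.ratio (c + n - 1) * (P.weight c (n + k) / P.weight c n *
        PowerSeries.coeff (k + 1) (binomPow P.b (-2 / P.lam - 2 * (c + n) + 2))) -
      P.ell c n * (P.conjCore c (Polynomial.X ^ (n + k))).coeff n =
    (P.conjCore c (assocDualRaising P.wilsonA P.wilsonB c (Polynomial.X ^ (n + k)))).coeff n := by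
  have hn := weight_ne_zero hc n
  have a1 := hc.1 (n + k)
  rw [assocDualRaising_X_pow, map_add, map_add, map_smul, map_smul, Polynomial.coeff_add,
    Polynomial.coeff_add, Polynomial.coeff_smul, Polynomial.coeff_smul, smul_eq_mul, smul_eq_mul,
    add_assoc n k 1, coeff_conjCore_add, coeff_conjCore_add, ← add_assoc n k 1, weight_succ, ell,
    add_comm (n : ℂ) c, add_comm ((n + k : ℕ) : ℂ) c]
  rcases k with _ | k
  · have h := P.coeff_row_zero hlam hkap hlk (z := c + n) rfl a1.1 a1.2.1 (hc.pred n)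
    have hlow : P.lowCoeff c n * (P.conjCore c (Polynomial.X ^ (n - 1))).coeff n = 0 := by
      rcases n with _ | n
      · rw [lowCoeff_zero, zero_mul]
      · rw [coeff_conjCore_of_lt P c (by omega), mul_zero]
    simp only [add_zero, zero_add]
    rw [hlow, PowerSeries.coeff_zero_eq_constantCoeff_apply, constantCoeff_binomPow, div_self hn,
      mul_div_right_comm, div_self hn]
    linear_combination h
  · have a0 := hc.1 (n + k)
    have e : c + ((n + (k + 1) : ℕ) : ℂ) - 1 = c + ((n + k : ℕ) : ℂ) := by push_cast; ring
    have h := P.coeff_row_succ hlam hkap hlk (z := c + (n + (k + 1) : ℕ)) (w := c + n) (k := k)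
      (by push_cast; ring) rfl a1.1 a1.2.1 (by rw [e]; exact a0.2.1) (hc.pred n)
    rw [e] at h
    rw [← add_assoc n k 1, Nat.add_sub_cancel, coeff_conjCore_add, lowCoeff_succ, weight_succ]
    rw [← add_assoc n k 1] at h
    linear_combination P.weight c (n + k) * (P.ratio (c + (n + k : ℕ)) * (c + (n + k : ℕ) + 1)) /
      P.weight c n * h

theorem sub_mul_conjCore {P : Params} (hlam : P.lam ≠ 0) (hkap : P.kap ≠ 0)
    (hlk : 1 / P.kap - 1 / P.lam = 1 / 2) {c : ℂ} (hc : P.Regular c) :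
    (mulX - diag (P.ell c)) * P.conjCore c =
      P.conjCore c * assocDualRaising P.wilsonA P.wilsonB c +
        ofMonomials fun m => Polynomial.C (P.defect c m) := by
  refine op_ext fun m => ?_
  rw [LinearMap.add_apply, ofMonomials_X_pow, Module.End.mul_apply, Module.End.mul_apply,
    LinearMap.sub_apply, mulX_apply]
  ext n
  rw [Polynomial.coeff_sub, coeff_diag, Polynomial.coeff_add, Polynomial.coeff_C]
  rcases n with _ | n
  -- In row 0 multiplication by `x` contributes nothing, so the row `-1` term of the identity
  -- remains and is, up to sign, the defect.
  · have h := row_identity hlam hkap hlk hc 0 m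
    have hw : P.weight c 0 = 1 := by simp [weight, calH, falling_zero]
    rw [zero_add, hw, Nat.cast_zero, add_zero, div_one] at h
    rw [if_pos rfl, Polynomial.coeff_X_mul_zero, ← h, defect]
    ring
  rw [if_neg (Nat.succ_ne_zero n), add_zero, Polynomial.coeff_X_mul]
  -- Row `n + 1` of the product with `x` is row `n` of `V`. By triangularity both sides vanish for
  -- `m < n`; for `m = n` both equal the leading coefficient `1`.
  rcases lt_trichotomy m n with hmn | rfl | hmn
  · rw [coeff_conjCore_of_lt P c hmn, coeff_conjCore_of_lt P c (by omega), assocDualRaising_X_pow,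
      map_add, map_add, map_smul, map_smul, Polynomial.coeff_add, Polynomial.coeff_add,
      Polynomial.coeff_smul, Polynomial.coeff_smul, coeff_conjCore_of_lt P c (by omega),
      coeff_conjCore_of_lt P c (by omega), coeff_conjCore_of_lt P c (by omega)]
    simp
  · have e0 := P.coeff_conjCore_add c m 0
    have e1 := P.coeff_conjCore_add c (m + 1) 0
    rw [add_zero, PowerSeries.coeff_zero_eq_constantCoeff_apply, constantCoeff_binomPow,
      div_self (weight_ne_zero hc _), mul_one] at e0 e1
    rw [e0, coeff_conjCore_of_lt P c (by omega), assocDualRaising_X_pow,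
      map_add, map_add, map_smul, map_smul, Polynomial.coeff_add, Polynomial.coeff_add,
      Polynomial.coeff_smul, Polynomial.coeff_smul, e1,
      coeff_conjCore_of_lt P c (by omega), coeff_conjCore_of_lt P c (by omega)]
    simp
  · obtain ⟨k, rfl⟩ := Nat.exists_eq_add_of_le (Nat.succ_le_of_lt hmn)
    have h := row_identity hlam hkap hlk hc (n + 1) k
    have hs := P.weight_succ c n
    have h0 := weight_ne_zero hc n
    have h1 := weight_ne_zero hc (n + 1)
    have e1 : c + ((n + 1 : ℕ) : ℂ) - 1 = c + n := by push_cast; ring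
    have e2 : -2 / P.lam - 2 * (c + ((n + 1 : ℕ) : ℂ)) + 2 = -2 / P.lam - 2 * (c + n) := by
      push_cast; ring
    rw [e1, e2] at h
    rw [Nat.succ_eq_add_one, ← h]
    congr 1
    rw [show n + 1 + k = n + (k + 1) by ring, coeff_conjCore_add]
    rw [hs] at h1 ⊢
    have h2 := right_ne_zero_of_mul h1
    have h3 := left_ne_zero_of_mul h2
    have h4 := right_ne_zero_of_mul h2
    push_cast
    rw [← add_assoc c]
    field_simp

/-! ### The correction factor `s(c, D)` -/

/-- The series to which the transpose of `C₂(c)⁻¹` is applied in the definition of `s(c, y)`. -/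
noncomputable def sSource (P : Params) (c : ℂ) : ℂ⟦X⟧ :=
  sdiag (fun n => (n.factorial : ℂ)⁻¹)
    (zeroDeriv (sdiag (fun n => falling (c + n - 1) n * P.calH (c - 1) n)
      (cpow (P.df.subst P.omega) (c - 1 + 1 / P.lam))))

/-- Moving the diagonal factor and the core to the series side reduces the pairing to
`bar_core_zeroDeriv`, whose coefficients are those of the defect. -/
theorem pairing_conjCore {P : Params} {c : ℂ} (hc : P.Regular c) (m : ℕ) :
    pairing (P.sSource c) (P.conjCore c (Polynomial.X ^ m)) = P.defect c m := by
  -- The shift by one in the `0`-derivative produces `(c+n)_{n+1} = (c+n)_n c` and one extra ratio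
  -- at `c - 1`. The left diagonal factor cancels everything except the constant `c · ratio (c -
  -- 1)`.
  have hv : sdiag (fun n => n.factorial / falling (c + n) n * (P.calH c n)⁻¹)
      (P.sSource c) =
      (c * P.ratio (c - 1)) •
        zeroDeriv (cpow (P.df.subst P.omega) (-(-c - 1 / P.lam) - 1)) := by
    rw [show -(-c - 1 / P.lam) - 1 = c - 1 + 1 / P.lam by ring]
    ext n
    have h1 := falling_ne_zero hc n
    have h2 := calH_ne_zero hc n
    have h3 := factorial_cast_ne_zero n
    have h4 : P.calH (c - 1) (n + 1) = P.ratio (c - 1) * P.calH c n := by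
      rw [calH, Finset.prod_range_succ', mul_comm, calH]
      congr 1
      · simp
      · refine Finset.prod_congr rfl fun k _ => ?_
        push_cast
        ring_nf
    have h5 : falling (c + (n + 1 : ℕ) - 1) (n + 1) = falling (c + n) n * c := by
      rw [show c + ((n + 1 : ℕ) : ℂ) - 1 = c + n by push_cast; ring, falling_succ,
        add_sub_cancel_right]
    simp only [sSource, sdiag, zeroDeriv, PowerSeries.coeff_mk, PowerSeries.coeff_smul,
      smul_eq_mul, h4, h5]
    field_simp
  have hb := congrArg (PowerSeries.coeff (m + 1)) (P.bar_core_zeroDeriv (-c - 1 / P.lam))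
  rw [PowerSeries.coeff_succ_mul_X, map_sub, PowerSeries.coeff_one, if_neg (Nat.succ_ne_zero m),
    zero_sub, show 2 * (-c - 1 / P.lam) + 2 = -2 / P.lam - 2 * c + 2 by ring] at hb
  have hm := factorial_cast_ne_zero m
  rw [conjCore_X_pow, map_smul, ← pairing_bar, bar_diag, hv, pairing_smul, ← pairing_bar,
    pairing_X_pow, hb, defect, smul_eq_mul]
  field_simp

theorem coeff_s_succ (P : Params) (c : ℂ) (n : ℕ) : PowerSeries.coeff (n + 1) (P.s c) =
    n.factorial * PowerSeries.coeff n (bar (Ring.inverse (P.C2 c))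
      (P.sSource c)) := by
  rw [sSource, s, map_add, PowerSeries.coeff_one, if_neg (Nat.succ_ne_zero n), zero_add,
    PowerSeries.coeff_succ_X_mul, sdiag, PowerSeries.coeff_mk]

theorem coeff_zero_s (P : Params) (c : ℂ) : PowerSeries.coeff 0 (P.s c) = 1 := by
  simp [s]

/-- The transpose of the inverse of `C2 c` in the definition of `s` cancels the `C2 c` standing
before `V`, so only the pairing of `sSource` with `V x^m` remains. -/
theorem correction_apply {P : Params} {c : ℂ} (hc : P.Regular c) (m : ℕ) :
    (ofMonomials fun n => Polynomial.C (PowerSeries.coeff (n + 1) (P.s c)))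
      (P.C2 c (P.conjCore c (Polynomial.X ^ m))) = Polynomial.C (P.defect c m) := by
  have hu : IsUnit (P.C2 c) := (isFamilyOperator_tildeC (P.ell c)).2.1
  have hl : (PowerSeries.mk fun n : ℕ => (n.factorial : ℂ)⁻¹ *
      PowerSeries.coeff (n + 1) (P.s c)) = bar (Ring.inverse (P.C2 c)) (P.sSource c) := by
    ext n
    rw [PowerSeries.coeff_mk, coeff_s_succ, inv_mul_cancel_left₀ (factorial_cast_ne_zero n)]
  rw [ofMonomials_C_apply, hl, pairing_bar, ← Module.End.mul_apply, Ring.inverse_mul_cancel _ hu,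
    Module.End.one_apply, pairing_conjCore hc]

theorem conj_serD_one (P : Params) (c : ℂ) :
    conjSerD (P.s c) 1 = 1 := by
  have := conj_serD_X_pow (P.s c) 0
  rw [pow_zero] at this
  rw [this]
  simp [coeff_zero_s]

theorem mulX_mul_assocG {P : Params} (hlam : P.lam ≠ 0) (hkap : P.kap ≠ 0)
    (hlk : 1 / P.kap - 1 / P.lam = 1 / 2) {c : ℂ} (hc : P.Regular c) :
    mulX * P.assocG c = P.assocG c * assocDualRaising P.wilsonA P.wilsonB c := by
  have h1 := mulX_mul_conj_serD (P.s c)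
  have h2 : mulX * P.C2 c = P.C2 c * (mulX - diag (P.ell c)) := mulX_mul_tildeC (P.ell c)
  have h3 := sub_mul_conjCore hlam hkap hlk hc
  rw [assocG_eq]
  have hone := P.conj_serD_one c
  set S := conjSerD (P.s c)
  -- Both errors have constant values, and `S` and `C2 c` fix `1`; the defect therefore passes
  -- through them unchanged.
  have h4 : (ofMonomials fun n => Polynomial.C (PowerSeries.coeff (n + 1) (P.s c))) *
      (P.C2 c * P.conjCore c) =
        S * (P.C2 c * ofMonomials fun m => Polynomial.C (P.defect c m)) := by
    refine op_ext fun m => ?_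
    rw [Module.End.mul_apply, Module.End.mul_apply, Module.End.mul_apply, Module.End.mul_apply,
      correction_apply hc, ofMonomials_X_pow, ← mul_one (Polynomial.C _),
      ← Polynomial.smul_eq_C_mul,
      map_smul, map_smul, show P.C2 c 1 = 1 from tildeC_one _, hone]
  rw [mul_assoc, ← mul_assoc mulX, h1, sub_mul, h4, mul_assoc S mulX, ← mul_assoc mulX (P.C2 c),
    h2, mul_assoc (P.C2 c), h3, mul_add, mul_add, add_sub_cancel_right]
  simp only [mul_assoc]

theorem assocG_one (P : Params) (c : ℂ) (hc : P.Regular c) : P.assocG c 1 = 1 := by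
  have hV : P.conjCore c 1 = 1 := by
    rw [← pow_zero (Polynomial.X : ℂ[X])]
    ext n
    rcases n with _ | n
    · have := P.coeff_conjCore_add c 0 0
      rw [zero_add, div_self (weight_ne_zero hc 0), one_mul,
        PowerSeries.coeff_zero_eq_constantCoeff_apply, constantCoeff_binomPow] at this
      rw [this]
      simp
    · rw [coeff_conjCore_of_lt P c (Nat.succ_pos n), pow_zero, Polynomial.coeff_one,
        if_neg (Nat.succ_ne_zero n)]
  rw [assocG_eq, Module.End.mul_apply, Module.End.mul_apply, hV,
    show P.C2 c 1 = 1 from tildeC_one _, conj_serD_one]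

theorem isFamilyOperator_assoc_iff {P : Params} (hlam : P.lam ≠ 0) (hkap : P.kap ≠ 0)
    (hlk : 1 / P.kap - 1 / P.lam = 1 / 2) {c : ℂ} (hc : P.Regular c) (G : Op) :
    IsFamilyOperator G (assocDualRaising P.wilsonA P.wilsonB c) ↔ G = P.assocG c := by
  have hU := P.assocDualRaising_X_pow c
  rw [isFamilyOperator_iff hU]
  constructor
  · rintro ⟨h1, h⟩
    exact eq_of_mulX_mul_eq hU h1 h (P.assocG_one c hc) (mulX_mul_assocG hlam hkap hlk hc)
  · rintro rfl
    exact ⟨P.assocG_one c hc, mulX_mul_assocG hlam hkap hlk hc⟩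

/-! ### The Wilson family as the case `c = 0` -/

/-- For `c = 0` the factor `(n)_{n+1}` vanishes, so the source series is zero whatever value the
ratio at `-1` takes. -/
theorem s_zero (P : Params) : P.s 0 = 1 := by
  ext n
  rcases n with _ | n
  · rw [coeff_zero_s, PowerSeries.coeff_one, if_pos rfl]
  · have hz : P.sSource 0 = 0 := by
      ext k
      simp only [sSource, sdiag, zeroDeriv, PowerSeries.coeff_mk, falling_succ, map_zero]
      push_cast
      ring
    have hp : pairing 0 = 0 := op_ext fun k => by simp [pairing_X_pow]
    rw [coeff_s_succ, hz, coeff_bar, hp, PowerSeries.coeff_one, if_neg (Nat.succ_ne_zero n),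
      LinearMap.zero_apply, mul_zero, mul_zero]

theorem falling_self (n : ℕ) : falling (0 + n) n = n.factorial := by
  rw [zero_add, falling, descPochhammer_eval_eq_descFactorial, Nat.descFactorial_self]

theorem assocG_zero (P : Params) : P.assocG 0 = P.wilsonG := by
  have h1 : (diag fun _ => (1 : ℂ)) = 1 := op_ext fun n => by rw [diag_X_pow, one_smul]; rfl
  have h2 : serD (1 : ℂ⟦X⟧) = 1 := bar_injective fun l => by
    rw [bar_serD, one_mul, ← h1, bar_diag]
    ext; simp [sdiag]
  have h3 : diag (fun n => (n.factorial : ℂ)) * diag (fun n => (n.factorial : ℂ)⁻¹) = 1 := by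
    rw [diag_mul_diag, ← h1]
    simp only [mul_inv_cancel₀ (factorial_cast_ne_zero _)]
  rw [assocG, wilsonG, s_zero, h2, mul_one, h3, one_mul]
  simp only [falling_self, div_self (factorial_cast_ne_zero _), h1, mul_one]
  rw [show -0 - 1 / P.lam = -1 / P.lam by ring]

theorem assocDualRaising_zero (P : Params) :
    assocDualRaising P.wilsonA P.wilsonB 0 = dualRaising P.wilsonA P.wilsonB := by
  refine op_ext fun m => ?_
  have hD := opD_pow_X_pow 1 m
  rw [pow_one, Nat.descFactorial_one] at hD
  rw [assocDualRaising_X_pow, dualRaising, LinearMap.add_apply, LinearMap.add_apply, mulX_apply,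
    diag_X_pow, Module.End.mul_apply, diag_X_pow, map_smul, hD, smul_smul, ← pow_succ', add_zero]
  congr 2
  rcases m with _ | m
  · simp [lowCoeff_zero]
  · rw [lowCoeff_succ, wilsonB]
    push_cast
    rw [add_sub_cancel_right, zero_add]
    ring

end Params
end WilsonAssoc

theorem mainTheorem9 (P : WilsonAssoc.Params) (hlam : P.lam ≠ 0) (hkap : P.kap ≠ 0)
    (hlk : 1 / P.kap - 1 / P.lam = 1 / 2) :
    -- the Wilson family and its recurrence coefficients
    (P.Regular 0 → IsFamilyOperator P.wilsonG (dualRaising P.wilsonA P.wilsonB)) ∧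
    -- the operator of the associated family
    (∀ c : ℂ, P.Regular c → ∀ G : Op,
      IsFamilyOperator G (assocDualRaising P.wilsonA P.wilsonB c) ↔ G = P.assocG c) ∧
    -- the operators with `T⁻¹ x T = x - ℓ_θ`
    (∀ (l : ℕ → ℂ) (T : Op),
      (IsUnit T ∧ T 1 = 1 ∧ Ring.inverse T * mulX * T = mulX - diag l) ↔ T = tildeC l) ∧
    -- the factorization behind hypergeometricity
    (∀ (l : ℕ → ℂ) (n : ℕ),
      sdiag (fun m => (m.factorial : ℂ))
        (bar (Ring.inverse (tildeC l))
          (sdiag (fun m => (m.factorial : ℂ)⁻¹) ((PowerSeries.X : PowerSeries ℂ) ^ n))) =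
      (PowerSeries.X : PowerSeries ℂ) ^ n *
        (∏ k ∈ Finset.range (n + 1), (1 + PowerSeries.C (l k) * PowerSeries.X))⁻¹) := by
  refine ⟨fun h0 => ?_, fun c hc G => Params.isFamilyOperator_assoc_iff hlam hkap hlk hc G,
    eq_tildeC_iff, sdiag_bar_inverse_tildeC⟩
  rw [← Params.assocDualRaising_zero, ← Params.assocG_zero]
  exact (Params.isFamilyOperator_assoc_iff hlam hkap hlk h0 _).mpr rfl
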